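/- For each dimension $d\ge 1$ let $f=N(0,I)$ be the standard Gaussian density on $\mathbb R^d$, let $\varphi=\varphi_d:\mathbb R^d\to\mathbb R$ be measurable, $q=q_d\in\mathbb R$, $\rho=\rho_d\in(0,1)$, $A=A_d=\{x:\varphi(x)\ge q\}$ and $p_f(A)=\mathbb P_f(X\in A)$. **Efficiency.** For a (possibly random) Gaussian density $g=N(\mu,\Sigma)$ put $\ell=f/g$ and let $Y_1,Y_2,\dots$ be, conditionally on $g$, i.i.d. with density $g$. A sequence $g=g_d$ is *efficient in high dimension for $A$* if for every sequence of integers $n_p=n_p(d)\to\infty$, $$\mathbb E\Big(\frac{\max_{i\le n_p}\ell(Y_i)}{\sum_{i\le n_p}\ell(Y_i)}\,\Big|\,g\Big)\Rightarrow 0\quad\text{and}\quad \mathbb E\Big(\Big|\frac1{p_f(A)\,n_p}\sum_{i\le n_p}\ell(Y_i)1_A(Y_i)-1\Big|\,\Big|\,g\Big)\Rightarrow 0\qquad(d\to\infty),$$ where $\Rightarrow$ is convergence in distribution (ordinary convergence if $g$ is deterministic). **Deterministic cross-entropy densities.** $g_0=f$, and $g_{t+1}=N(\mu_{t+1},\Sigma_{t+1})$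 where $\mu_{t+1}$ and $\Sigma_{t+1}$ are the mean and covariance matrix of $f$ conditioned on $A_t=\{\varphi>q_t\}$, with $q_t=\inf\{u:F(u)\ge 1-\rho\}$ and $F$ the cumulative distribution function of $\varphi(X)$, $X\sim g_t$. **Stochastic cross-entropy densities**, with integer sample sizes $m=m(d)$ and $n_g=n_g(d)$: $\hat g_0=f$; given $\hat g_t$, draw independent samples $Y'_1,\dots,Y'_m$ and $Y_1,\dots,Y_{n_g}$, all i.i.d. from $\hat g_t$, let $\hat q_t=\varphi(Y'_{(\lfloor(1-\rho)m\rfloor)})$ be the value of rank $\lfloor(1-\rho)m\rfloor$ among $\varphi(Y'_1),\dots,\varphi(Y'_m)$ ranked in increasing order ($\hat q_t=-\infty$ if this rank is $0$), $\hat A_t=\{\varphi>\hat q_t\}$, $\ell=f/\hat g_t$, and $$\hat p_t=\frac1{n_g}\sum_i\ell(Y_i)1_{\hat A_t}(Y_i),\qquad \hat\mu_{t+1}=\frac1{n_g\hat p_t}\sum_i\ell(Y_i)1_{\hat A_t}(Y_i)Y_i,$$ $$\hat\Sigma_{t+1}=\frac1{n_g\hat p_t}\sum_i\ell(Y_i)1_{\hat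 A_t}(Y_i)Y_iY_i^\top-\hat\mu_{t+1}\hat\mu_{t+1}^\top,\qquad \hat g_{t+1}=N(\hat\mu_{t+1},\hat\Sigma_{t+1}).$$ (If $\hat g_t$ is degenerate, $\ell$ is taken to be $0$, and if $\hat p_t=0$ then $1/\hat p_t$ is taken to be $0$.) **Theorem.** Assume that $\inf_d p_f(A)>0$, that $\inf_d\rho>0$, and that for every $d$ the function $\varphi$ has no atom, i.e. $\varphi^{-1}(\{u\})$ is Lebesgue-null for every $u\in\mathbb R$. Then for every $t\ge 0$, $g_t$ is efficient in high dimension for $A$. Assume in addition that $m\to\infty$. Then for each $t\ge 0$ there exists a finite constant $\kappa_t>0$ such that, for every sequence $n_g$ with $n_g/d^{\kappa_t}\to\infty$, $\hat g_t$ is efficient in high dimension for $A$. -/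

import Mathlib

open MeasureTheory ProbabilityTheory Filter Topology
open scoped ENNReal

namespace CrossEntropy

/-- The Euclidean space `ℝ^d`. -/
abbrev E (d : ℕ) : Type := EuclideanSpace ℝ (Fin d)

/-- Real `d × d` matrices carry the product (equivalently, Borel) σ-algebra. -/
instance instMeasurableSpaceMatrix (d : ℕ) : MeasurableSpace (Matrix (Fin d) (Fin d) ℝ) :=
  inferInstanceAs (MeasurableSpace (Fin d → Fin d → ℝ))

instance instBorelSpaceMatrix (d : ℕ) : BorelSpace (Matrix (Fin d) (Fin d) ℝ) :=
  inferInstanceAs (BorelSpace (Fin d → Fin d → ℝ))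

/-- The parameter `(μ, Σ)` of a Gaussian distribution on `ℝ^d`. -/
abbrev Param (d : ℕ) : Type := E d × Matrix (Fin d) (Fin d) ℝ

/-- The Gaussian distribution `N(μ, Σ)`, `θ = (μ, Σ)`, as a measure
(it is defined for singular positive semidefinite `Σ` as well). -/
noncomputable def gaussian {d : ℕ} (θ : Param d) : Measure (E d) :=
  multivariateGaussian θ.1 θ.2

/-- The density of `N(μ, Σ)`, `θ = (μ, Σ)`. If `Σ` is singular there is no density, and the
expression is `0`. -/
noncomputable def gaussianDensity {d : ℕ} (θ : Param d) (x : E d) : ℝ :=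
  (Real.sqrt ((2 * Real.pi) ^ d * θ.2.det))⁻¹ *
    Real.exp (-(1 / 2) * dotProduct (x - θ.1).ofLp (θ.2⁻¹.mulVec (x - θ.1).ofLp))

/-- The parameter `(0, I)` of the standard Gaussian distribution `f = N(0, I)`. -/
noncomputable def stdParam (d : ℕ) : Param d := (0, 1)

/-- The likelihood ratio `ℓ = f / g` with `g = N(μ, Σ)`, `θ = (μ, Σ)`. -/
noncomputable def likelihoodRatio {d : ℕ} (θ : Param d) (x : E d) : ℝ :=
  gaussianDensity (stdParam d) x / gaussianDensity θ x

/-- `p_f(A)`, the probability of `A` under the standard Gaussian distribution. -/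
noncomputable def probF {d : ℕ} (A : Set (E d)) : ℝ := (gaussian (stdParam d)).real A

/-- The law of `n` i.i.d. random vectors distributed according to `N(μ, Σ)`. -/
noncomputable def iidGaussian {d : ℕ} (n : ℕ) (θ : Param d) : Measure (Fin n → E d) :=
  Measure.pi fun _ => gaussian θ

/-! ### Efficiency in high dimension -/

/-- `E (max_i ℓ(Y_i) / ∑_i ℓ(Y_i) | g)` with `Y_1, …, Y_n` i.i.d. distributed according to `g`,
where `g = N(μ, Σ)`, `θ = (μ, Σ)`. -/
noncomputable def maxWeightRatio {d : ℕ} (n : ℕ) (θ : Param d) : ℝ≥0∞ :=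
  ∫⁻ y, ENNReal.ofReal
    ((⨆ i, likelihoodRatio θ (y i)) / ∑ i, likelihoodRatio θ (y i)) ∂(iidGaussian n θ)

/-- `E (|(1 / (p_f(A) n)) ∑_i ℓ(Y_i) 1_A(Y_i) - 1| | g)` with `Y_1, …, Y_n` i.i.d. distributed
according to `g`, where `g = N(μ, Σ)`, `θ = (μ, Σ)`. -/
noncomputable def estimatorError {d : ℕ} (A : Set (E d)) (n : ℕ) (θ : Param d) : ℝ≥0∞ :=
  ∫⁻ y, ENNReal.ofReal
    |1 / (probF A * n) * ∑ i, A.indicator (likelihoodRatio θ) (y i) - 1| ∂(iidGaussian n θ)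

/-- High-dimensional efficiency for `A` of a sequence (indexed by the dimension `d ≥ 1`) of
possibly random Gaussian auxiliary distributions `g = N(μ, Σ)`, the random parameter `θ d = (μ, Σ)`
being defined on the probability space `(Ω d, P d)`. Both conditional expectations, which are random
variables as functions of `g`, converge in distribution to the constant `0`. -/
def EfficientInHighDim {Ω : ℕ+ → Type} [∀ d, MeasurableSpace (Ω d)]
    (P : ∀ d, Measure (Ω d)) [∀ d, IsProbabilityMeasure (P d)]
    (θ : ∀ d : ℕ+, Ω d → Param d) (A : ∀ d : ℕ+, Set (E d)) : Prop :=
  ∀ np : ℕ+ → ℕ, Tendsto np atTop atTop →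
    TendstoInDistribution (fun d ω => maxWeightRatio (np d) (θ d ω)) atTop
      (fun _ : Unit => (0 : ℝ≥0∞)) P (Measure.dirac ()) ∧
    TendstoInDistribution (fun d ω => estimatorError (A d) (np d) (θ d ω)) atTop
      (fun _ : Unit => (0 : ℝ≥0∞)) P (Measure.dirac ())

/-! ### The deterministic cross-entropy scheme -/

/-- The quantile `F⁻¹(1 - ρ) = inf {u | F u ≥ 1 - ρ}`, where `F` is the cumulative distribution
function of `φ(X)` with `X` distributed according to `N(μ, Σ)`, `θ = (μ, Σ)`. -/
noncomputable def quantile {d : ℕ} (φ : E d → ℝ) (ρ : ℝ) (θ : Param d) : ℝ :=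
  sInf {u : ℝ | 1 - ρ ≤ cdf ((gaussian θ).map φ) u}

/-- Mean and covariance matrix of `f|_B`, the standard Gaussian distribution conditioned
on `B`. -/
noncomputable def condParam {d : ℕ} (B : Set (E d)) : Param d :=
  (∫ x, x ∂((gaussian (stdParam d))[|B]),
    Matrix.of fun i j => cov[fun x => x i, fun x => x j; (gaussian (stdParam d))[|B]])

/-- The parameters `(μ_t, Σ_t)` of the deterministic cross-entropy densities
`g_t = N(μ_t, Σ_t)`. -/
noncomputable def detParam {d : ℕ} (φ : E d → ℝ) (ρ : ℝ) : ℕ → Param d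
  | 0 => stdParam d
  | t + 1 => condParam {x | quantile φ ρ (detParam φ ρ t) < φ x}

/-! ### The stochastic cross-entropy scheme -/

/-- The `k`-th smallest value `u_(k)` of `u_1, …, u_m`, `1 ≤ k ≤ m`, the values being ranked in
increasing order `u_(1) ≤ ⋯ ≤ u_(m)`. By convention `u_(0) = -∞` (rank `0` only occurs
when `(1 - ρ) m < 1`). -/
noncomputable def orderStat {m : ℕ} (u : Fin m → ℝ) (k : ℕ) : EReal :=
  if h : 1 ≤ k ∧ k ≤ m then ((u (Tuple.sort u ⟨k - 1, by omega⟩) : ℝ) : EReal) else ⊥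

/-- The empirical quantile `q̂ = φ(y'_([(1 - ρ) m]))` of the sample `y'`. -/
noncomputable def empQuantile {d m : ℕ} (φ : E d → ℝ) (ρ : ℝ) (y' : Fin m → E d) : EReal :=
  orderStat (fun i => φ (y' i)) ⌊(1 - ρ) * m⌋₊

/-- The weights `ℓ(x) 1_Â(x)` with `ℓ = f / ĝ` and `Â = {x | φ x > q̂}`, where `ĝ = N(μ, Σ)`,
`θ = (μ, Σ)`, and `q̂` is the empirical quantile of the sample `y'`. -/
noncomputable def ceWeight {d m : ℕ} (φ : E d → ℝ) (ρ : ℝ) (θ : Param d) (y' : Fin m → E d)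
    (x : E d) : ℝ :=
  {x : E d | empQuantile φ ρ y' < (φ x : EReal)}.indicator (likelihoodRatio θ) x

/-- `p̂ = (1 / n) ∑_i ℓ(Y_i) 1_Â(Y_i)`. -/
noncomputable def ceProb {d m n : ℕ} (φ : E d → ℝ) (ρ : ℝ) (θ : Param d) (y' : Fin m → E d)
    (y : Fin n → E d) : ℝ :=
  1 / (n : ℝ) * ∑ i, ceWeight φ ρ θ y' (y i)

/-- `μ̂ = (1 / (n p̂)) ∑_i ℓ(Y_i) 1_Â(Y_i) Y_i`. -/
noncomputable def ceMean {d m n : ℕ} (φ : E d → ℝ) (ρ : ℝ) (θ : Param d) (y' : Fin m → E d)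
    (y : Fin n → E d) : E d :=
  (1 / (n * ceProb φ ρ θ y' y)) • ∑ i, ceWeight φ ρ θ y' (y i) • y i

/-- `Σ̂ = (1 / (n p̂)) ∑_i ℓ(Y_i) 1_Â(Y_i) Y_i Y_iᵀ - μ̂ μ̂ᵀ`. -/
noncomputable def ceCov {d m n : ℕ} (φ : E d → ℝ) (ρ : ℝ) (θ : Param d) (y' : Fin m → E d)
    (y : Fin n → E d) : Matrix (Fin d) (Fin d) ℝ :=
  (1 / (n * ceProb φ ρ θ y' y)) •
      ∑ i, ceWeight φ ρ θ y' (y i) • Matrix.vecMulVec (y i).ofLp (y i).ofLp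
    - Matrix.vecMulVec (ceMean φ ρ θ y' y).ofLp (ceMean φ ρ θ y' y).ofLp

/-- The law of the next parameter `(μ̂, Σ̂)` computed by one iteration of the stochastic
cross-entropy scheme from the current density `ĝ = N(μ, Σ)`, `θ = (μ, Σ)`: the samples `Y'` (of
size `m`) and `Y` (of size `n`) are independent and i.i.d. according to `ĝ`. -/
noncomputable def ceStepLaw {d : ℕ} (φ : E d → ℝ) (ρ : ℝ) (m n : ℕ) (θ : Param d) :
    Measure (Param d) :=
  ((iidGaussian m θ).prod (iidGaussian n θ)).map
    fun s => (ceMean φ ρ θ s.1 s.2, ceCov φ ρ θ s.1 s.2)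

/-! #### Measurability of the transition -/

section Measurability

open scoped MatrixOrder

variable {d m n : ℕ}

open scoped Matrix.Norms.L2Operator in
theorem continuousOn_sqrt :
    ContinuousOn (CFC.sqrt : Matrix (Fin d) (Fin d) ℝ → Matrix (Fin d) (Fin d) ℝ)
      {S | S.PosSemidef} := by
  simp_rw [← Matrix.nonneg_iff_posSemidef]
  exact CFC.continuousOn_sqrt

theorem isClosed_posSemidef : IsClosed {S : Matrix (Fin d) (Fin d) ℝ | S.PosSemidef} := by
  simp only [Matrix.posSemidef_iff_dotProduct_mulVec, Set.ofPred_and, Set.ofPred_forall]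
  refine IsClosed.inter (isClosed_eq (by fun_prop) (by fun_prop)) (isClosed_iInter fun x => ?_)
  exact isClosed_le (by fun_prop) (by fun_prop)

theorem measurable_sqrt :
    Measurable (CFC.sqrt : Matrix (Fin d) (Fin d) ℝ → Matrix (Fin d) (Fin d) ℝ) := by
  have h0 : ∀ S : Matrix (Fin d) (Fin d) ℝ, ¬ S.PosSemidef → CFC.sqrt S = 0 := by
    intro S hS
    rw [CFC.sqrt, cfcₙ_apply_of_not_predicate]
    change ¬ (S - 0).PosSemidef
    simpa
  refine measurable_of_restrict_of_restrict_compl (s := {S | S.PosSemidef})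
    isClosed_posSemidef.measurableSet ?_ ?_
  · exact (continuousOn_iff_continuous_domRestrict.1 continuousOn_sqrt).measurable
  · have : Set.domRestrict {S : Matrix (Fin d) (Fin d) ℝ | S.PosSemidef}ᶜ CFC.sqrt = fun _ => 0 := by
      ext1 S
      exact h0 S.1 S.2
    rw [this]
    exact measurable_const

/-- The affine map `z ↦ μ + Σ^{1/2} z`, `θ = (μ, Σ)`. -/
noncomputable def affineMap (θ : Param d) (z : E d) : E d :=
  θ.1 + Matrix.toEuclideanCLM (𝕜 := ℝ) (CFC.sqrt θ.2) z

theorem measurable_affineMap : Measurable fun p : Param d × E d => affineMap p.1 p.2 := by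
  have h : Measurable fun p : Param d × E d => CFC.sqrt p.1.2 := measurable_sqrt.comp (by fun_prop)
  have hij : ∀ i j, Measurable fun p : Param d × E d => CFC.sqrt p.1.2 i j := fun i j =>
    (measurable_pi_apply j).comp ((measurable_pi_apply i).comp h)
  have h2 : Measurable fun p : Param d × E d =>
      (WithLp.toLp 2 (fun i => ∑ j, CFC.sqrt p.1.2 i j * p.2 j) : E d) := by
    refine (WithLp.measurable_toLp 2 _).comp (measurable_pi_lambda _ fun i => ?_)
    refine Finset.measurable_sum _ fun j _ => (hij i j).mul (by fun_prop)
  have h3 : (fun p : Param d × E d => affineMap p.1 p.2) = fun p => p.1.1 +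
      (WithLp.toLp 2 (fun i => ∑ j, (CFC.sqrt p.1.2 : Matrix (Fin d) (Fin d) ℝ) i j * p.2 j) : E d) := by
    ext p i
    simp [affineMap, Matrix.mulVec, dotProduct]
  rw [h3]
  exact Measurable.add (by fun_prop) h2

instance instIsProbabilityMeasureGaussian (θ : Param d) : IsProbabilityMeasure (gaussian θ) := by
  unfold gaussian; infer_instance

instance instIsProbabilityMeasureIidGaussian (θ : Param d) :
    IsProbabilityMeasure (iidGaussian n θ) := by
  unfold iidGaussian; infer_instance

theorem iidGaussian_eq_map (n : ℕ) (θ : Param d) :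
    iidGaussian n θ =
      (Measure.pi fun _ : Fin n => stdGaussian (E d)).map fun z i => affineMap θ (z i) := by
  have hm : Measurable (affineMap θ) :=
    measurable_affineMap.comp (measurable_const.prodMk measurable_id)
  have : ∀ _ : Fin n, IsProbabilityMeasure ((stdGaussian (E d)).map (affineMap θ)) :=
    fun _ => Measure.isProbabilityMeasure_map hm.aemeasurable
  rw [Measure.pi_map_pi (fun _ => hm.aemeasurable)]
  rfl

theorem measurable_gaussianDensity :
    Measurable fun p : Param d × E d => gaussianDensity p.1 p.2 := by
  have hS : ∀ i j, Measurable fun p : Param d × E d => p.1.2 i j := fun i j =>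
    (measurable_pi_apply j).comp ((measurable_pi_apply i).comp (by fun_prop))
  have hcont : Measurable fun S : Matrix (Fin d) (Fin d) ℝ => S.det :=
    (Continuous.matrix_det continuous_id).measurable
  have hdet : Measurable fun p : Param d × E d => p.1.2.det := hcont.comp (by fun_prop)
  have hadj : Measurable fun S : Matrix (Fin d) (Fin d) ℝ => S.adjugate :=
    (Continuous.matrix_adjugate continuous_id).measurable
  have hinv : ∀ i j, Measurable fun p : Param d × E d => p.1.2⁻¹ i j := by
    intro i j
    have : (fun p : Param d × E d => p.1.2⁻¹ i j) =
        fun p => (p.1.2.det)⁻¹ * p.1.2.adjugate i j := by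
      ext p
      simp [Matrix.inv_def]
    rw [this]
    refine hdet.inv.mul ?_
    exact (measurable_pi_apply j).comp ((measurable_pi_apply i).comp (hadj.comp (by fun_prop)))
  unfold gaussianDensity
  simp only [dotProduct, Matrix.mulVec]
  refine Measurable.mul (Measurable.inv (Measurable.sqrt (hdet.const_mul _))) ?_
  refine Real.measurable_exp.comp (Measurable.const_mul ?_ _)
  refine Finset.measurable_sum _ fun i _ => Measurable.mul (by fun_prop) ?_
  exact Finset.measurable_sum _ fun j _ => Measurable.mul (hinv i j) (by fun_prop)

theorem measurable_likelihoodRatio {α : Type} [MeasurableSpace α] {θ : α → Param d} {x : α → E d}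
    (hθ : Measurable θ) (hx : Measurable x) : Measurable fun a => likelihoodRatio (θ a) (x a) := by
  have h1 : Measurable fun a => gaussianDensity (stdParam d) (x a) :=
    measurable_gaussianDensity.comp (measurable_const.prodMk hx)
  have h2 : Measurable fun a => gaussianDensity (θ a) (x a) :=
    measurable_gaussianDensity.comp (hθ.prodMk hx)
  exact h1.div h2

theorem measurable_orderStat (k : ℕ) : Measurable fun u : Fin m → ℝ => orderStat u k := by
  unfold orderStat
  split_ifs with h
  · refine Measurable.coe_real_ereal (measurable_of_Iic fun a => ?_)
    have : (fun u : Fin m → ℝ => u (Tuple.sort u ⟨k - 1, by omega⟩)) ⁻¹' Set.Iic a =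
        {u | k - 1 < ∑ i, (if u i ≤ a then 1 else 0)} := by
      ext u
      have h1 := Tuple.lt_card_le_iff_apply_le_of_monotone (f := u ∘ Tuple.sort u)
        (a := a) (j := ⟨k - 1, by omega⟩) (Tuple.monotone_sort u)
      have h2 : ∑ i, (if u i ≤ a then 1 else 0) =
          ∑ i, (if u (Tuple.sort u i) ≤ a then 1 else 0) :=
        (Equiv.sum_comp (Tuple.sort u) fun i => if u i ≤ a then 1 else 0).symm
      simp only [Set.mem_preimage, Set.mem_Iic, Set.mem_ofPred_eq, h2]
      rw [← Finset.card_filter]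
      exact h1.symm
    rw [this]
    refine measurableSet_lt measurable_const (Finset.measurable_sum _ fun i _ => ?_)
    exact Measurable.ite (measurableSet_le (by fun_prop) (by fun_prop)) measurable_const
      measurable_const
  · exact measurable_const

variable {φ : E d → ℝ}

theorem measurable_ceWeight {α : Type} [MeasurableSpace α] {θ : α → Param d}
    {y' : α → Fin m → E d} {x : α → E d} (hφ : Measurable φ) (ρ : ℝ)
    (hθ : Measurable θ) (hy' : Measurable y') (hx : Measurable x) :
    Measurable fun a => ceWeight φ ρ (θ a) (y' a) (x a) := by
  have hq : Measurable fun a => empQuantile φ ρ (y' a) :=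
    (measurable_orderStat _).comp
      (measurable_pi_lambda _ fun i => hφ.comp ((measurable_pi_apply i).comp hy'))
  have hs : MeasurableSet {a | empQuantile φ ρ (y' a) < (φ (x a) : EReal)} :=
    measurableSet_lt hq (hφ.comp hx).coe_real_ereal
  have heq : (fun a => ceWeight φ ρ (θ a) (y' a) (x a)) =
      {a | empQuantile φ ρ (y' a) < (φ (x a) : EReal)}.indicator
        fun a => likelihoodRatio (θ a) (x a) := by
    ext a
    by_cases h : empQuantile φ ρ (y' a) < (φ (x a) : EReal) <;>
      simp [ceWeight, Set.indicator, h]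
  rw [heq]
  exact (measurable_likelihoodRatio hθ hx).indicator hs

theorem measurable_ceMean_ceCov {α : Type} [MeasurableSpace α] {θ : α → Param d}
    {y' : α → Fin m → E d} {y : α → Fin n → E d} (hφ : Measurable φ) (ρ : ℝ)
    (hθ : Measurable θ) (hy' : Measurable y') (hy : Measurable y) :
    Measurable fun a =>
      ((ceMean φ ρ (θ a) (y' a) (y a), ceCov φ ρ (θ a) (y' a) (y a)) : Param d) := by
  have hyi : ∀ i, Measurable fun a => y a i := fun i => (measurable_pi_apply i).comp hy
  have hw : ∀ i, Measurable fun a => ceWeight φ ρ (θ a) (y' a) (y a i) := fun i =>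
    measurable_ceWeight hφ ρ hθ hy' (hyi i)
  have hp : Measurable fun a => 1 / (n * ceProb φ ρ (θ a) (y' a) (y a)) := by
    have h1 : Measurable fun a => ∑ i, ceWeight φ ρ (θ a) (y' a) (y a i) :=
      Finset.measurable_sum Finset.univ fun i _ => hw i
    exact ((h1.const_mul _).const_mul _).const_div _
  have hmean : Measurable fun a => ceMean φ ρ (θ a) (y' a) (y a) :=
    hp.smul (Finset.measurable_sum _ fun i _ => (hw i).smul (hyi i))
  have hco : ∀ {z : α → E d}, Measurable z → ∀ c : Fin d, Measurable fun a => z a c :=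
    fun hz c => (measurable_pi_apply c).comp ((WithLp.measurable_ofLp 2 _).comp hz)
  refine hmean.prodMk ?_
  refine measurable_pi_lambda _ fun b => measurable_pi_lambda _ fun c => ?_
  have : (fun a => ceCov φ ρ (θ a) (y' a) (y a) b c) =
      fun a => (1 / (n * ceProb φ ρ (θ a) (y' a) (y a))) *
        (∑ i, ceWeight φ ρ (θ a) (y' a) (y a i) * ((y a i) b * (y a i) c))
        - (ceMean φ ρ (θ a) (y' a) (y a)) b * (ceMean φ ρ (θ a) (y' a) (y a)) c := by
    ext a
    simp [ceCov, Matrix.vecMulVec_apply, Matrix.sum_apply]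
  rw [this]
  refine (hp.mul (Finset.measurable_sum _ fun i _ => (hw i).mul ?_)).sub ?_
  · exact (hco (hyi i) b).mul (hco (hyi i) c)
  · exact (hco hmean b).mul (hco hmean c)

theorem measurable_affine_sample {α : Type} [MeasurableSpace α] {θ : α → Param d}
    {z : α → Fin n → E d} (hθ : Measurable θ) (hz : Measurable z) :
    Measurable fun a i => affineMap (θ a) (z a i) :=
  measurable_pi_lambda _ fun i =>
    measurable_affineMap.comp (hθ.prodMk ((measurable_pi_apply i).comp hz))

theorem ceStepLaw_eq_map (hφ : Measurable φ) (ρ : ℝ) (m n : ℕ) (θ : Param d) :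
    ceStepLaw φ ρ m n θ = ((Measure.pi fun _ : Fin m => stdGaussian (E d)).prod
      (Measure.pi fun _ : Fin n => stdGaussian (E d))).map fun z =>
        (ceMean φ ρ θ (fun i => affineMap θ (z.1 i)) (fun i => affineMap θ (z.2 i)),
          ceCov φ ρ θ (fun i => affineMap θ (z.1 i)) (fun i => affineMap θ (z.2 i))) := by
  have h1 : ∀ k : ℕ, Measurable fun (z : Fin k → E d) i => affineMap θ (z i) := fun k =>
    measurable_affine_sample measurable_const measurable_id
  rw [ceStepLaw, iidGaussian_eq_map, iidGaussian_eq_map, Measure.map_prod_map _ _ (h1 m) (h1 n),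
    Measure.map_map
      (measurable_ceMean_ceCov hφ ρ measurable_const measurable_fst measurable_snd)
      ((h1 m).prodMap (h1 n))]
  rfl

theorem measurable_ceStepLaw (hφ : Measurable φ) (ρ : ℝ) (m n : ℕ) :
    Measurable (ceStepLaw φ ρ m n) := by
  have hH : Measurable fun p : Param d × ((Fin m → E d) × (Fin n → E d)) =>
      ((ceMean φ ρ p.1 (fun i => affineMap p.1 (p.2.1 i)) (fun i => affineMap p.1 (p.2.2 i)),
        ceCov φ ρ p.1 (fun i => affineMap p.1 (p.2.1 i)) (fun i => affineMap p.1 (p.2.2 i))) :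
          Param d) :=
    measurable_ceMean_ceCov hφ ρ measurable_fst
      (measurable_affine_sample measurable_fst (measurable_fst.comp measurable_snd))
      (measurable_affine_sample measurable_fst (measurable_snd.comp measurable_snd))
  refine Measure.measurable_of_measurable_coe _ fun s hs => ?_
  have heq : (fun θ => ceStepLaw φ ρ m n θ s) = fun θ =>
      ((Measure.pi fun _ : Fin m => stdGaussian (E d)).prod
        (Measure.pi fun _ : Fin n => stdGaussian (E d))) (Prod.mk θ ⁻¹'
        ((fun p : Param d × ((Fin m → E d) × (Fin n → E d)) =>
          ((ceMean φ ρ p.1 (fun i => affineMap p.1 (p.2.1 i)) (fun i => affineMap p.1 (p.2.2 i)),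
            ceCov φ ρ p.1 (fun i => affineMap p.1 (p.2.1 i)) (fun i => affineMap p.1 (p.2.2 i))) :
              Param d)) ⁻¹' s)) := by
    ext θ
    rw [ceStepLaw_eq_map hφ]
    exact Measure.map_apply (hH.comp measurable_prodMk_left) hs
  rw [heq]
  exact measurable_measure_prodMk_left (hH hs)

end Measurability

/-- The transition kernel of one iteration of the stochastic cross-entropy scheme. -/
noncomputable def ceKernel {d : ℕ} (φ : E d → ℝ) (hφ : Measurable φ) (ρ : ℝ) (m n : ℕ) :
    Kernel (Param d) (Param d) where
  toFun := ceStepLaw φ ρ m n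
  measurable' := measurable_ceStepLaw hφ ρ m n

instance instIsMarkovKernelCeKernel {d : ℕ} (φ : E d → ℝ) (hφ : Measurable φ) (ρ : ℝ) (m n : ℕ) :
    IsMarkovKernel (ceKernel φ hφ ρ m n) where
  isProbabilityMeasure _ := Measure.isProbabilityMeasure_map
    (measurable_ceMean_ceCov hφ ρ measurable_const measurable_fst measurable_snd).aemeasurable

/-- The law of the random parameter `(μ̂_t, Σ̂_t)` of the stochastic cross-entropy density
`ĝ_t = N(μ̂_t, Σ̂_t)`: the parameters form a Markov chain started from `(0, I)`. -/
noncomputable def ceLaw {d : ℕ} (φ : E d → ℝ) (hφ : Measurable φ) (ρ : ℝ) (m n : ℕ) :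
    ℕ → Measure (Param d)
  | 0 => Measure.dirac (stdParam d)
  | t + 1 => (ceLaw φ hφ ρ m n t).bind (ceKernel φ hφ ρ m n)

instance instIsProbabilityMeasureCeLaw {d : ℕ} (φ : E d → ℝ) (hφ : Measurable φ) (ρ : ℝ)
    (m n t : ℕ) : IsProbabilityMeasure (ceLaw φ hφ ρ m n t) := by
  induction t with
  | zero => unfold ceLaw; infer_instance
  | succ t ih => unfold ceLaw; infer_instance

end CrossEntropy

/-!
Write `f = N(0, I)`, `g = N(μ, Σ)` and `ℓ = f / g`. Everything is controlled by the Kullback–Leibler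
divergence `KL(g | f) = (‖μ‖² + tr Σ - log det Σ - d) / 2` (`gaussKL`), and the point is that the
cross-entropy schemes stay in a ball `KL(g | f) ≤ C` (`klBall`) with `C` independent of the
dimension.

*Balls are efficient.* In an eigenbasis of `Σ` the likelihood ratio is a product of functions of
independent Gaussian coordinates. If `KL(g | f) ≤ C`, the eigenvalues of `Σ` are at least
`exp (-(1 + 2 C))`, and one-dimensional Gaussian integrals bound `∫ ℓ ^ α df` by a constant, with
`α > 0` and the constant depending on `C` only (`integral_exp_logRatio_le`). So `ℓ` has a polynomial
tail under `f`. Truncating `ℓ` at the level `√n` gives a weak law of large numbers for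
`(1 / n) ∑ ℓ(Y_i) F(Y_i)`, `F ∈ L²(f)`, in mean and at a polynomial rate
(`integral_abs_weighted_mean_sub_le_rate`); both efficiency criteria follow
(`efficientInHighDim_of_klBall`).

*Conditioning stays in a ball.* If `ν` is `f` conditioned on `B`, Jensen's inequality for the
function `log (g / f)`, whose exponential has integral `1` under `f`, gives
`∫ log (g / f) dν ≤ log (1 / p_f(B))` for every nondegenerate Gaussian `g`. Since `log (g / f)` is
quadratic, for the `g` with the moments of `ν` the left-hand side is `KL(g | f)`
(`condParam_mem_klBall`). Conversely, a set of `g`-probability at least `ρ` has `f`-probability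
bounded below in terms of `ρ` and `KL(g | f)` (`exp_le_probF`). As `φ` has no atom, `A_t` has
`g_t`-probability `ρ`, so the deterministic scheme stays in balls by induction.

*The stochastic scheme.* As `m → ∞`, the empirical quantile selects a set `Â_t` of probability at
least `ρ / 2` under the current density with probability tending to one
(`measure_empQuantile_bad_le`). By the rate in the law of large numbers, all of the `(d + 1)²`
empirical moments of `f` restricted to `Â_t` are precise up to a small multiple of `d⁻²` once `n_g`
exceeds a large power of `d`, whose exponent is dictated by `C`. Jensen's inequality, applied this
time to the density with the *perturbed* moments, shows that this precision suffices to stay in a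
ball (`mem_klBall_of_near`). The radius depends on the previous radius and on `ρ` but not on
the sample, which is why the exponent of `d` can be chosen in advance.
-/

namespace CrossEntropy

open scoped RealInnerProductSpace

/-! ### Spectral coordinates -/

section Spectral

variable {d : ℕ}

/-- The orthonormal basis `b` diagonalizes the positive definite matrix `S`, with positive
eigenvalues `lam`. -/
structure Diagonalizes (S : Matrix (Fin d) (Fin d) ℝ) (b : OrthonormalBasis (Fin d) ℝ (E d))
    (lam : Fin d → ℝ) : Prop where
  pos : ∀ i, 0 < lam i
  eig : ∀ i, S.mulVec (b i).ofLp = lam i • (b i).ofLp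
  det : S.det = ∏ i, lam i
  trace : S.trace = ∑ i, lam i

theorem exists_diagonalizes {S : Matrix (Fin d) (Fin d) ℝ} (hS : S.PosDef) :
    ∃ b lam, Diagonalizes S b lam :=
  ⟨hS.isHermitian.eigenvectorBasis, hS.isHermitian.eigenvalues, hS.eigenvalues_pos,
    hS.isHermitian.mulVec_eigenvectorBasis, by simpa using hS.isHermitian.det_eq_prod_eigenvalues,
    by simpa using hS.isHermitian.trace_eq_sum_eigenvalues⟩

theorem dotProduct_eq_inner (x y : E d) : dotProduct x.ofLp y.ofLp = ⟪x, y⟫ := by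
  simp [PiLp.inner_apply, dotProduct, mul_comm]

theorem mulVec_ofLp_sum (M : Matrix (Fin d) (Fin d) ℝ) (c : Fin d → ℝ)
    (b : OrthonormalBasis (Fin d) ℝ (E d)) :
    M.mulVec (∑ i, c i • b i).ofLp = ∑ i, c i • M.mulVec (b i).ofLp := by
  simp only [WithLp.ofLp_sum, WithLp.ofLp_smul]
  rw [← Matrix.mulVecLin_apply, map_sum]
  simp

variable {S : Matrix (Fin d) (Fin d) ℝ} {b : OrthonormalBasis (Fin d) ℝ (E d)} {lam : Fin d → ℝ}

theorem dotProduct_mulVec_of_eig (c : Fin d → ℝ)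
    (h : ∀ i, S.mulVec (b i).ofLp = c i • (b i).ofLp) (x : E d) :
    dotProduct x.ofLp (S.mulVec x.ofLp) = ∑ i, c i * ⟪b i, x⟫ ^ 2 := by
  have hx : S.mulVec x.ofLp = (∑ i, ⟪b i, x⟫ • c i • b i : E d).ofLp := by
    conv_lhs => rw [← b.sum_repr' x]
    rw [mulVec_ofLp_sum]
    simp [WithLp.ofLp_sum, h]
  rw [hx, dotProduct_eq_inner, inner_sum]
  refine Finset.sum_congr rfl fun i _ => ?_
  rw [inner_smul_right, inner_smul_right, real_inner_comm]
  ring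

theorem Diagonalizes.det_pos (h : Diagonalizes S b lam) : 0 < S.det :=
  h.det ▸ Finset.prod_pos fun i _ => h.pos i

theorem Diagonalizes.quadForm (h : Diagonalizes S b lam) (x : E d) :
    dotProduct x.ofLp (S.mulVec x.ofLp) = ∑ i, lam i * ⟪b i, x⟫ ^ 2 :=
  dotProduct_mulVec_of_eig lam h.eig x

theorem Diagonalizes.quadForm_inv (h : Diagonalizes S b lam) (x : E d) :
    dotProduct x.ofLp (S⁻¹.mulVec x.ofLp) = ∑ i, (lam i)⁻¹ * ⟪b i, x⟫ ^ 2 := by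
  refine dotProduct_mulVec_of_eig _ (fun i => ?_) x
  have h1 : S⁻¹.mulVec (S.mulVec (b i).ofLp) = (b i).ofLp := by
    rw [Matrix.mulVec_mulVec, Matrix.nonsing_inv_mul _ (isUnit_iff_ne_zero.2 h.det_pos.ne'),
      Matrix.one_mulVec]
  rw [h.eig, Matrix.mulVec_smul] at h1
  rw [← h1, smul_smul, inv_mul_cancel₀ (h.pos i).ne', one_smul, h1]

theorem Diagonalizes.quadForm_basis (h : Diagonalizes S b lam) (i : Fin d) :
    dotProduct (b i).ofLp (S.mulVec (b i).ofLp) = lam i := by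
  rw [h.eig, dotProduct_smul, dotProduct_eq_inner]
  simp

/-- The logarithm `log (f / g)` of the likelihood ratio of `f = N(0, I)` with respect to
`g = N(μ, Σ)`, for positive definite `Σ`. -/
noncomputable def logRatio (θ : Param d) (x : E d) : ℝ :=
  (Real.log θ.2.det - ‖x‖ ^ 2 +
    dotProduct (x - θ.1).ofLp (θ.2⁻¹.mulVec (x - θ.1).ofLp)) / 2

/-- The Kullback–Leibler divergence `(‖μ‖² + tr Σ - log det Σ - d) / 2` of `N(μ, Σ)` with respect
to `N(0, I)`, for positive definite `Σ`. -/
noncomputable def gaussKL (θ : Param d) : ℝ :=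
  (‖θ.1‖ ^ 2 + θ.2.trace - Real.log θ.2.det - d) / 2

theorem likelihoodRatio_eq_exp {θ : Param d} (h : 0 < θ.2.det) (x : E d) :
    likelihoodRatio θ x = Real.exp (logRatio θ x) := by
  have hpi : 0 < (2 * Real.pi) ^ d := by positivity
  have h1 : dotProduct x.ofLp x.ofLp = ‖x‖ ^ 2 := by
    rw [dotProduct_eq_inner, real_inner_self_eq_norm_sq]
  have hs : Real.sqrt θ.2.det = Real.exp (Real.log θ.2.det / 2) := by
    rw [Real.sqrt_eq_rpow, Real.rpow_def_of_pos h]; ring_nf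
  unfold likelihoodRatio gaussianDensity logRatio stdParam
  simp only [Matrix.det_one, mul_one, inv_one, Matrix.one_mulVec, sub_zero, h1]
  rw [Real.sqrt_mul hpi.le, hs]
  have hne : Real.sqrt ((2 * Real.pi) ^ d) ≠ 0 := (Real.sqrt_pos.2 hpi).ne'
  rw [mul_inv, mul_assoc, mul_div_mul_left _ _ (inv_ne_zero hne), ← Real.exp_neg, ← Real.exp_add,
    ← Real.exp_sub]
  congr 1
  ring

theorem Diagonalizes.logRatio_eq {μ : E d} (h : Diagonalizes S b lam) (x : E d) :
    logRatio (μ, S) x = ∑ i, (Real.log (lam i) - ⟪b i, x⟫ ^ 2 +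
      (⟪b i, x⟫ - ⟪b i, μ⟫) ^ 2 / lam i) / 2 := by
  unfold logRatio
  simp only
  rw [h.quadForm_inv, h.det, Real.log_prod fun i _ => (h.pos i).ne', ← b.sum_sq_inner_right x,
    ← Finset.sum_sub_distrib, ← Finset.sum_add_distrib, Finset.sum_div]
  refine Finset.sum_congr rfl fun i _ => ?_
  rw [inner_sub_right]
  ring

theorem Diagonalizes.gaussKL_eq {μ : E d} (h : Diagonalizes S b lam) :
    gaussKL (μ, S) = ∑ i, (⟪b i, μ⟫ ^ 2 + (lam i - 1 - Real.log (lam i))) / 2 := by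
  unfold gaussKL
  simp only
  rw [h.trace, h.det, Real.log_prod fun i _ => (h.pos i).ne', ← b.sum_sq_inner_right μ,
    ← Finset.sum_div]
  simp only [Finset.sum_add_distrib, Finset.sum_sub_distrib]
  simp
  ring

end Spectral

/-! ### Gaussian laws in spectral coordinates -/

section Density

theorem gaussianPDFReal_std_mul_exp {b s : ℝ} (hs : 0 < 1 + s) (z : ℝ) :
    gaussianPDFReal 0 1 z * Real.exp (b * z - s * z ^ 2 / 2) =
      Real.exp (b ^ 2 / (2 * (1 + s)) - Real.log (1 + s) / 2) *
        gaussianPDFReal (b / (1 + s)) (1 + s)⁻¹.toNNReal z := by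
  have h1 : Real.sqrt (2 * Real.pi * (1 + s)⁻¹) =
      Real.sqrt (2 * Real.pi) * Real.exp (-(Real.log (1 + s) / 2)) := by
    rw [Real.sqrt_mul (by positivity), Real.sqrt_eq_rpow (1 + s)⁻¹,
      Real.rpow_def_of_pos (inv_pos.2 hs), Real.log_inv]
    ring_nf
  rw [gaussianPDFReal_def, gaussianPDFReal_def]
  simp only [NNReal.coe_one, mul_one, sub_zero, Real.coe_toNNReal _ (inv_pos.2 hs).le]
  rw [h1, mul_inv, ← Real.exp_neg, neg_neg, mul_assoc, mul_left_comm (Real.exp _),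
    mul_assoc (Real.sqrt (2 * Real.pi))⁻¹, ← Real.exp_add, ← Real.exp_add, ← Real.exp_add]
  congr 2
  field_simp
  ring

theorem gaussianPDFReal_std_eq {m v : ℝ} (hv : 0 < v) (z : ℝ) :
    gaussianPDFReal 0 1 z =
      Real.exp ((Real.log v - z ^ 2 + (z - m) ^ 2 / v) / 2) * gaussianPDFReal m v.toNNReal z := by
  have h1 : Real.sqrt (2 * Real.pi * v) =
      Real.sqrt (2 * Real.pi) * Real.exp (Real.log v / 2) := by
    rw [Real.sqrt_mul (by positivity), Real.sqrt_eq_rpow v, Real.rpow_def_of_pos hv]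
    ring_nf
  rw [gaussianPDFReal_def, gaussianPDFReal_def]
  simp only [NNReal.coe_one, mul_one, sub_zero, Real.coe_toNNReal _ hv.le]
  rw [h1, mul_inv, ← Real.exp_neg, mul_left_comm, mul_assoc, ← Real.exp_add, ← Real.exp_add]
  congr 2
  field_simp
  ring

theorem integral_exp_quadratic_gaussianReal {b s : ℝ} (hs : 0 < 1 + s) :
    Integrable (fun z => Real.exp (b * z - s * z ^ 2 / 2)) (gaussianReal 0 1) ∧
      ∫ z, Real.exp (b * z - s * z ^ 2 / 2) ∂(gaussianReal 0 1) =
        Real.exp (b ^ 2 / (2 * (1 + s)) - Real.log (1 + s) / 2) := by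
  have hv : (1 + s)⁻¹.toNNReal ≠ 0 := by
    rw [ne_eq, Real.toNNReal_eq_zero, not_le]; positivity
  constructor
  · rw [gaussianReal_of_var_ne_zero 0 one_ne_zero,
      integrable_withDensity_iff_integrable_smul' (measurable_gaussianPDF _ _)
        (ae_of_all _ fun _ => gaussianPDF_lt_top)]
    simp only [toReal_gaussianPDF, smul_eq_mul, gaussianPDFReal_std_mul_exp hs]
    exact (integrable_gaussianPDFReal _ _).const_mul _
  · rw [integral_gaussianReal_eq_integral_smul one_ne_zero]
    simp only [smul_eq_mul, gaussianPDFReal_std_mul_exp hs]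
    rw [integral_const_mul, integral_gaussianPDFReal_eq_one _ hv, mul_one]

theorem gaussianReal_withDensity {m v : ℝ} (hv : 0 < v) :
    (gaussianReal m v.toNNReal).withDensity
      (fun z => ENNReal.ofReal (Real.exp ((Real.log v - z ^ 2 + (z - m) ^ 2 / v) / 2))) =
        gaussianReal 0 1 := by
  have hv' : v.toNNReal ≠ 0 := by rwa [ne_eq, Real.toNNReal_eq_zero, not_le]
  rw [gaussianReal_of_var_ne_zero _ hv', gaussianReal_of_var_ne_zero _ one_ne_zero,
    ← withDensity_mul _ (measurable_gaussianPDF _ _) (by fun_prop)]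
  congr 1
  ext z
  rw [Pi.mul_apply, gaussianPDF, gaussianPDF, mul_comm, ← ENNReal.ofReal_mul (by positivity),
    ← gaussianPDFReal_std_eq hv]

/-- A product of measures with densities has the product density. -/
theorem pi_withDensity_ofReal {ι α : Type*} [Fintype ι] [MeasurableSpace α] (μ : ι → Measure α)
    [∀ i, SigmaFinite (μ i)] (r : ι → α → ℝ) (hr : ∀ i, Measurable (r i))
    (hr0 : ∀ i x, 0 ≤ r i x)
    (hν : ∀ i, IsProbabilityMeasure ((μ i).withDensity fun x => ENNReal.ofReal (r i x))) :
    (Measure.pi μ).withDensity (fun x => ENNReal.ofReal (∏ i, r i (x i))) =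
      Measure.pi fun i => (μ i).withDensity fun x => ENNReal.ofReal (r i x) := by
  have hint : ∀ i, Integrable (r i) (μ i) := by
    intro i
    refine ⟨(hr i).aestronglyMeasurable, ?_⟩
    rw [hasFiniteIntegral_iff_ofReal (ae_of_all _ (hr0 i))]
    have := (hν i).measure_univ
    rw [withDensity_apply _ MeasurableSet.univ, Measure.restrict_univ] at this
    simp [this]
  refine (Measure.pi_eq fun s hs => ?_).symm
  have h1 : ∀ x : ι → α, (Set.univ.pi s).indicator
      (fun x => ENNReal.ofReal (∏ i, r i (x i))) x =
        ENNReal.ofReal (∏ i, (s i).indicator (r i) (x i)) := by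
    intro x
    by_cases hx : x ∈ Set.univ.pi s
    · rw [Set.indicator_of_mem hx]
      congr 1
      exact Finset.prod_congr rfl fun i _ => (Set.indicator_of_mem (hx i trivial) _).symm
    · rw [Set.indicator_of_notMem hx]
      simp only [Set.mem_pi, not_forall] at hx
      obtain ⟨i, -, hi⟩ := hx
      rw [Finset.prod_eq_zero (Finset.mem_univ i) (Set.indicator_of_notMem hi _)]
      simp
  have h0 : ∀ i x, 0 ≤ (s i).indicator (r i) x := fun i x =>
    Set.indicator_nonneg (fun x _ => hr0 i x) x
  rw [withDensity_apply _ (MeasurableSet.univ_pi hs),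
    ← lintegral_indicator (MeasurableSet.univ_pi hs)]
  simp_rw [h1]
  rw [← ofReal_integral_eq_lintegral_ofReal
      (Integrable.fintype_prod_dep fun i => (hint i).indicator (hs i))
      (ae_of_all _ fun x => Finset.prod_nonneg fun i _ => h0 i _),
    integral_fintype_prod_eq_prod, ENNReal.ofReal_prod_of_nonneg
      fun i _ => integral_nonneg (h0 i)]
  refine Finset.prod_congr rfl fun i _ => ?_
  rw [ofReal_integral_eq_lintegral_ofReal ((hint i).indicator (hs i)) (ae_of_all _ (h0 i)),
    withDensity_apply _ (hs i), ← lintegral_indicator (hs i)]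
  congr 1
  ext x
  by_cases hx : x ∈ s i <;> simp [hx]

variable {d : ℕ} {S : Matrix (Fin d) (Fin d) ℝ} {b : OrthonormalBasis (Fin d) ℝ (E d)}
  {lam : Fin d → ℝ}

theorem inner_basis_sum (b : OrthonormalBasis (Fin d) ℝ (E d)) (z : Fin d → ℝ) (i : Fin d) :
    ⟪b i, ∑ j, z j • b j⟫ = z i := by
  rw [b.orthonormal.inner_right_fintype]

theorem gaussian_stdParam : gaussian (stdParam d) = stdGaussian (E d) :=
  multivariateGaussian_zero_one

theorem gaussian_stdParam_eq_map (b : OrthonormalBasis (Fin d) ℝ (E d)) :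
    gaussian (stdParam d) =
      (Measure.pi fun _ : Fin d => gaussianReal 0 1).map (fun z => ∑ i, z i • b i) := by
  rw [gaussian_stdParam, stdGaussian_eq_map_pi_orthonormalBasis b]

/-- In an orthonormal eigenbasis of `Σ`, the coordinates of a random vector with law `N(μ, Σ)` are
independent Gaussian variables whose variances are the eigenvalues. -/
theorem Diagonalizes.gaussian_eq_map (hS : S.PosSemidef) (h : Diagonalizes S b lam) (μ : E d) :
    gaussian (μ, S) = (Measure.pi fun i : Fin d => gaussianReal ⟪b i, μ⟫ (lam i).toNNReal).map
      (fun z => ∑ i, z i • b i) := by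
  have hm : Measurable fun z : Fin d → ℝ => ∑ i, z i • b i :=
    Finset.measurable_sum _ fun i _ => by fun_prop
  have : IsProbabilityMeasure ((Measure.pi fun i : Fin d =>
      gaussianReal ⟪b i, μ⟫ (lam i).toNNReal).map (fun z => ∑ i, z i • b i)) :=
    Measure.isProbabilityMeasure_map hm.aemeasurable
  refine Measure.ext_of_charFun ?_
  ext t
  rw [gaussian, charFun_multivariateGaussian hS, charFun_apply, integral_map hm.aemeasurable
    (Measurable.aestronglyMeasurable (by fun_prop))]
  simp_rw [sum_inner, Complex.ofReal_sum, Finset.sum_mul, Complex.exp_sum]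
  rw [integral_fintype_prod_eq_prod (f := fun i (x : ℝ) =>
    Complex.exp (⟪x • b i, t⟫ * Complex.I))]
  simp_rw [real_inner_smul_left, mul_comm _ (⟪_, _⟫), Complex.ofReal_mul, ← charFun_apply_real,
    charFun_gaussianReal]
  rw [← Complex.exp_sum, h.quadForm, ← b.sum_inner_mul_inner t μ]
  congr 1
  push_cast
  rw [Finset.sum_mul, Finset.sum_div, ← Finset.sum_sub_distrib]
  refine Finset.sum_congr rfl fun i _ => ?_
  rw [real_inner_comm t (b i)]
  simp only [Real.coe_toNNReal _ (h.pos i).le]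

theorem measurable_logRatio (θ : Param d) : Measurable (logRatio θ) := by
  unfold logRatio
  simp only [dotProduct, Matrix.mulVec]
  fun_prop

theorem measurable_exp_logRatio (θ : Param d) : Measurable fun x => Real.exp (logRatio θ x) :=
  Real.measurable_exp.comp (measurable_logRatio θ)

/-- Change of measure: `f = ℓ g`. -/
theorem gaussian_withDensity {θ : Param d} (hθ : θ.2.PosDef) :
    (gaussian θ).withDensity (fun x => ENNReal.ofReal (Real.exp (logRatio θ x))) =
      gaussian (stdParam d) := by
  obtain ⟨b, lam, h⟩ := exists_diagonalizes hθ
  have hm : Measurable fun z : Fin d → ℝ => ∑ i, z i • b i :=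
    Finset.measurable_sum _ fun i _ => by fun_prop
  have hr : Measurable fun x => ENNReal.ofReal (Real.exp (logRatio θ x)) :=
    (measurable_exp_logRatio θ).ennreal_ofReal
  have hp := pi_withDensity_ofReal (fun i : Fin d => gaussianReal ⟪b i, θ.1⟫ (lam i).toNNReal)
    (fun i z => Real.exp ((Real.log (lam i) - z ^ 2 + (z - ⟪b i, θ.1⟫) ^ 2 / lam i) / 2))
    (fun i => by fun_prop) (fun i z => by positivity)
    (fun i => by rw [gaussianReal_withDensity (h.pos i)]; infer_instance)
  simp_rw [gaussianReal_withDensity (h.pos _)] at hp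
  rw [gaussian_stdParam_eq_map b, ← hp, show gaussian θ = _ from
    h.gaussian_eq_map hθ.posSemidef θ.1]
  ext s hs
  rw [withDensity_apply _ hs, setLIntegral_map hs hr hm, Measure.map_apply hm hs,
    withDensity_apply _ (hm hs)]
  congr 1
  ext z
  congr 1
  rw [show θ = (θ.1, θ.2) from rfl, h.logRatio_eq, Real.exp_sum]
  simp [inner_basis_sum]

theorem lintegral_gaussian_mul {θ : Param d} (hθ : θ.2.PosDef) {F : E d → ℝ≥0∞}
    (hF : Measurable F) :
    ∫⁻ x, ENNReal.ofReal (Real.exp (logRatio θ x)) * F x ∂(gaussian θ) =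
      ∫⁻ x, F x ∂(gaussian (stdParam d)) := by
  rw [← gaussian_withDensity hθ, lintegral_withDensity_eq_lintegral_mul _
    (measurable_exp_logRatio θ).ennreal_ofReal hF]
  rfl

theorem integrable_gaussian_mul {θ : Param d} (hθ : θ.2.PosDef) {F : E d → ℝ} :
    Integrable (fun x => Real.exp (logRatio θ x) * F x) (gaussian θ) ↔
      Integrable F (gaussian (stdParam d)) := by
  rw [← gaussian_withDensity hθ, integrable_withDensity_iff_integrable_smul'
    (measurable_exp_logRatio θ).ennreal_ofReal (by simp)]
  simp [ENNReal.toReal_ofReal (Real.exp_pos _).le]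

theorem integral_gaussian_mul {θ : Param d} (hθ : θ.2.PosDef) (F : E d → ℝ) :
    ∫ x, Real.exp (logRatio θ x) * F x ∂(gaussian θ) = ∫ x, F x ∂(gaussian (stdParam d)) := by
  rw [← gaussian_withDensity hθ, integral_withDensity_eq_integral_toReal_smul
    (measurable_exp_logRatio θ).ennreal_ofReal (by simp)]
  simp [ENNReal.toReal_ofReal (Real.exp_pos _).le]

theorem lintegral_exp_neg_logRatio {θ : Param d} (hθ : θ.2.PosDef) :
    ∫⁻ x, ENNReal.ofReal (Real.exp (-logRatio θ x)) ∂(gaussian (stdParam d)) = 1 := by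
  have hm : Measurable fun x => ENNReal.ofReal (Real.exp (-logRatio θ x)) :=
    (Real.measurable_exp.comp (measurable_logRatio θ).neg).ennreal_ofReal
  rw [← lintegral_gaussian_mul hθ hm]
  simp [← ENNReal.ofReal_mul (Real.exp_pos _).le, ← Real.exp_add]

theorem gaussian_absolutelyContinuous {θ : Param d} (hθ : θ.2.PosDef) :
    gaussian θ ≪ gaussian (stdParam d) := by
  rw [← gaussian_withDensity hθ]
  exact withDensity_absolutelyContinuous'
    (measurable_exp_logRatio θ).ennreal_ofReal.aemeasurable (by simp [Real.exp_pos])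

theorem stdGaussian_absolutelyContinuous_volume :
    gaussian (stdParam d) ≪ (volume : Measure (E d)) := by
  have h1 : gaussianReal 0 1 =
      volume.withDensity fun x => ENNReal.ofReal (gaussianPDFReal 0 1 x) :=
    gaussianReal_of_var_ne_zero 0 one_ne_zero
  have h2 := pi_withDensity_ofReal (fun _ : Fin d => (volume : Measure ℝ))
    (fun _ => gaussianPDFReal 0 1) (fun _ => measurable_gaussianPDFReal 0 1)
    (fun _ => gaussianPDFReal_nonneg 0 1) (fun _ => by rw [← h1]; infer_instance)
  rw [gaussian_stdParam, ← map_pi_eq_stdGaussian, ← (PiLp.volume_preserving_toLp (Fin d)).map_eq]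
  refine Measure.AbsolutelyContinuous.map ?_ (by fun_prop)
  rw [h1, ← h2, ← volume_pi]
  exact withDensity_absolutelyContinuous _ _

end Density

/-! ### Power moments of the likelihood ratio -/

section Tail

theorem sq_le_sub_one_sub_log {u : ℝ} (h0 : 0 < u) (h1 : u ≤ 1) :
    (1 - u) ^ 2 ≤ 2 * (u - 1 - Real.log u) := by
  have hw : |1 - u| < 1 := by rw [abs_lt]; constructor <;> linarith
  have h := Real.hasSum_pow_div_log_of_abs_lt_one hw
  have h2 := sum_le_hasSum (Finset.range 2) (fun i _ => by
    have : 0 ≤ 1 - u := by linarith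
    positivity) h
  simp [Finset.sum_range_succ] at h2
  norm_num at h2
  linarith

theorem inv_sub_one_sub_log_le {x : ℝ} (h1 : 1 ≤ x) :
    x⁻¹ - 1 + Real.log x ≤ x - 1 - Real.log x := by
  have h0 : 0 < x := by linarith
  have h := Real.self_le_sinh_iff.2 (Real.log_nonneg h1)
  rw [Real.sinh_log h0] at h
  linarith

theorem one_sub_inv_sq_le {c x : ℝ} (hc : 0 < c) (hc1 : c ≤ 1) (hx : c ≤ x) :
    c ^ 2 * (1 - x⁻¹) ^ 2 ≤ 2 * (x - 1 - Real.log x) := by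
  have h0 : 0 < x := by linarith
  rcases le_total x 1 with h1 | h1
  · have h := sq_le_sub_one_sub_log h0 h1
    have h2 : (1 - x⁻¹) ^ 2 = (1 - x) ^ 2 * (x⁻¹) ^ 2 := by field_simp; ring
    have h3 : (c * x⁻¹) ^ 2 ≤ 1 := by
      have : c * x⁻¹ ≤ 1 := by rw [← div_eq_mul_inv, div_le_one h0]; exact hx
      have : 0 ≤ c * x⁻¹ := by positivity
      nlinarith
    calc c ^ 2 * (1 - x⁻¹) ^ 2 = (1 - x) ^ 2 * (c * x⁻¹) ^ 2 := by rw [h2]; ring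
      _ ≤ (1 - x) ^ 2 * 1 := by gcongr
      _ ≤ _ := by linarith
  · have h := sq_le_sub_one_sub_log (inv_pos.2 h0) (inv_le_one_of_one_le₀ h1)
    rw [Real.log_inv] at h
    have h2 := inv_sub_one_sub_log_le h1
    have h3 : c ^ 2 * (1 - x⁻¹) ^ 2 ≤ 1 * (1 - x⁻¹) ^ 2 := by
      gcongr; nlinarith
    linarith

theorem inv_sub_one_add_log_le {c x : ℝ} (hc : 0 < c) (hc1 : c ≤ 1) (hx : c ≤ x) :
    c * (x⁻¹ - 1 + Real.log x) ≤ 2 * (x - 1 - Real.log x) := by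
  have h0 : 0 < x := by linarith
  have hp : 0 ≤ x - 1 - Real.log x := by linarith [Real.log_le_sub_one_of_pos h0]
  rcases le_total x 1 with h1 | h1
  · have h := sq_le_sub_one_sub_log h0 h1
    have h2 : x⁻¹ - 1 + Real.log x + (x - 1 - Real.log x) = (1 - x) ^ 2 * x⁻¹ := by
      field_simp; ring
    have h3 : c * x⁻¹ ≤ 1 := by rw [← div_eq_mul_inv, div_le_one h0]; exact hx
    calc c * (x⁻¹ - 1 + Real.log x) ≤ c * ((1 - x) ^ 2 * x⁻¹) := by gcongr; linarith
      _ = (1 - x) ^ 2 * (c * x⁻¹) := by ring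
      _ ≤ (1 - x) ^ 2 * 1 := by gcongr
      _ ≤ _ := by linarith
  · have h2 := inv_sub_one_sub_log_le h1
    have h3 : 0 ≤ x⁻¹ - 1 + Real.log x := by
      have := Real.log_le_sub_one_of_pos (inv_pos.2 h0)
      rw [Real.log_inv] at this
      linarith
    have : c * (x⁻¹ - 1 + Real.log x) ≤ 1 * (x⁻¹ - 1 + Real.log x) := by gcongr
    linarith

theorem sub_two_mul_sq_le_log {s : ℝ} (hs : -(1 / 2) ≤ s) : s - 2 * s ^ 2 ≤ Real.log (1 + s) := by
  have h0 : 0 < 1 + s := by linarith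
  have h := Real.log_le_sub_one_of_pos (inv_pos.2 h0)
  rw [Real.log_inv] at h
  have h2 : s - 2 * s ^ 2 ≤ 1 - (1 + s)⁻¹ := by
    rw [← sub_nonneg]
    have : 1 - (1 + s)⁻¹ - (s - 2 * s ^ 2) = s ^ 2 * (1 + 2 * s) / (1 + s) := by field_simp; ring
    rw [this]
    have : 0 ≤ 1 + 2 * s := by linarith
    positivity
  linarith

/-- The one-dimensional factor of the power moment `∫ ℓ ^ (c / 2) df`. -/
theorem integral_exp_coordinate {c lam m : ℝ} (hc : 0 < c) (hc1 : c ≤ 1) (hl : c ≤ lam) :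
    Integrable (fun z => Real.exp (c / 2 * ((Real.log lam - z ^ 2 + (z - m) ^ 2 / lam) / 2)))
      (gaussianReal 0 1) ∧
    ∫ z, Real.exp (c / 2 * ((Real.log lam - z ^ 2 + (z - m) ^ 2 / lam) / 2)) ∂(gaussianReal 0 1) ≤
      Real.exp (m ^ 2 + (lam - 1 - Real.log lam)) := by
  have h0 : 0 < lam := by linarith
  set a : ℝ := c / 2 with ha
  set s : ℝ := a * (1 - lam⁻¹) with hs
  have hcl : c * lam⁻¹ ≤ 1 := by rw [← div_eq_mul_inv, div_le_one h0]; exact hl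
  have hl0 : 0 < lam⁻¹ := inv_pos.2 h0
  have hs1 : -(1 / 2) ≤ s := by rw [hs, ha]; nlinarith
  have hs2 : 1 / 2 ≤ 1 + s := by linarith
  have heq : ∀ z : ℝ, Real.exp (a * ((Real.log lam - z ^ 2 + (z - m) ^ 2 / lam) / 2)) =
      Real.exp (a / 2 * (Real.log lam + m ^ 2 * lam⁻¹)) *
        Real.exp ((-(a * m * lam⁻¹)) * z - s * z ^ 2 / 2) := by
    intro z
    rw [← Real.exp_add]
    congr 1
    rw [hs]
    ring
  simp_rw [heq]
  obtain ⟨h1, h2⟩ := integral_exp_quadratic_gaussianReal (b := -(a * m * lam⁻¹)) (s := s)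
    (by linarith)
  refine ⟨h1.const_mul _, ?_⟩
  rw [integral_const_mul, h2, ← Real.exp_add]
  apply Real.exp_le_exp.2
  have e1 : (-(a * m * lam⁻¹)) ^ 2 / (2 * (1 + s)) ≤ (a * m * lam⁻¹) ^ 2 := by
    rw [neg_sq]
    exact div_le_self (sq_nonneg _) (by linarith)
  have e2 := sub_two_mul_sq_le_log hs1
  have e3 := one_sub_inv_sq_le hc hc1 hl
  have e4 := inv_sub_one_add_log_le hc hc1 hl
  have e5 : s ^ 2 ≤ (lam - 1 - Real.log lam) / 2 := by
    have : s ^ 2 = c ^ 2 * (1 - lam⁻¹) ^ 2 / 4 := by rw [hs, ha]; ring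
    linarith
  have e6 : (a * m * lam⁻¹) ^ 2 ≤ m ^ 2 / 4 := by
    have : (a * m * lam⁻¹) ^ 2 = m ^ 2 / 4 * (c * lam⁻¹) ^ 2 := by rw [ha]; ring
    rw [this]
    have : (c * lam⁻¹) ^ 2 ≤ 1 := by
      have : 0 ≤ c * lam⁻¹ := by positivity
      nlinarith
    nlinarith [sq_nonneg m]
  have e7 : a / 2 * (m ^ 2 * lam⁻¹) ≤ m ^ 2 / 4 := by
    have : a / 2 * (m ^ 2 * lam⁻¹) = m ^ 2 / 4 * (c * lam⁻¹) := by rw [ha]; ring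
    rw [this]
    nlinarith [sq_nonneg m]
  have e8 : a / 2 * Real.log lam - s / 2 = c * (lam⁻¹ - 1 + Real.log lam) / 4 := by
    rw [hs, ha]; ring
  nlinarith [sq_nonneg m]

variable {d : ℕ}

/-- The nondegenerate Gaussian parameters at Kullback–Leibler divergence at most `C` from
`N(0, I)`. -/
def klBall (d : ℕ) (C : ℝ) : Set (Param d) := {θ | θ.2.PosDef ∧ gaussKL θ ≤ C}

/-- A lower bound for the eigenvalues of the covariance matrices of the parameters in
`klBall d C`. -/
noncomputable def eigBound (C : ℝ) : ℝ := Real.exp (-(1 + 2 * C))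

theorem eigBound_pos (C : ℝ) : 0 < eigBound C := Real.exp_pos _

theorem eigBound_le_one {C : ℝ} (hC : 0 ≤ C) : eigBound C ≤ 1 :=
  Real.exp_le_one_iff.2 (by linarith)

variable {S : Matrix (Fin d) (Fin d) ℝ} {b : OrthonormalBasis (Fin d) ℝ (E d)} {lam : Fin d → ℝ}

theorem Diagonalizes.term_le (h : Diagonalizes S b lam) (μ : E d) (i : Fin d) :
    ⟪b i, μ⟫ ^ 2 + (lam i - 1 - Real.log (lam i)) ≤ 2 * gaussKL (μ, S) := by
  rw [h.gaussKL_eq, Finset.mul_sum]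
  have := Finset.single_le_sum (f := fun i => 2 * ((⟪b i, μ⟫ ^ 2 +
    (lam i - 1 - Real.log (lam i))) / 2)) (fun j _ => by
      have := Real.log_le_sub_one_of_pos (h.pos j)
      have := sq_nonneg ⟪b j, μ⟫
      linarith) (Finset.mem_univ i)
  linarith

theorem Diagonalizes.gaussKL_nonneg (h : Diagonalizes S b lam) (μ : E d) : 0 ≤ gaussKL (μ, S) := by
  rw [h.gaussKL_eq]
  refine Finset.sum_nonneg fun j _ => ?_
  have := Real.log_le_sub_one_of_pos (h.pos j)
  have := sq_nonneg ⟪b j, μ⟫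
  linarith

theorem Diagonalizes.eigBound_le (h : Diagonalizes S b lam) {μ : E d} {C : ℝ}
    (hC : gaussKL (μ, S) ≤ C) (i : Fin d) : eigBound C ≤ lam i := by
  have h1 := h.term_le μ i
  have h2 := h.pos i
  rw [eigBound, ← Real.le_log_iff_exp_le h2]
  nlinarith [sq_nonneg ⟪b i, μ⟫]

theorem gaussKL_nonneg {θ : Param d} (h : θ.2.PosDef) : 0 ≤ gaussKL θ := by
  obtain ⟨b, lam, hb⟩ := exists_diagonalizes h
  exact hb.gaussKL_nonneg θ.1

/-- Over `klBall d C`, a power of the likelihood ratio, of an exponent that depends only on `C`,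
has a moment under `f` bounded by a constant that depends only on `C`. -/
theorem integral_exp_logRatio_le {C : ℝ} {θ : Param d} (hθ : θ ∈ klBall d C) :
    Integrable (fun x => Real.exp (eigBound C / 2 * logRatio θ x)) (gaussian (stdParam d)) ∧
    ∫ x, Real.exp (eigBound C / 2 * logRatio θ x) ∂(gaussian (stdParam d)) ≤
      Real.exp (2 * C) := by
  obtain ⟨b, lam, h⟩ := exists_diagonalizes hθ.1
  have hC0 : 0 ≤ C := (gaussKL_nonneg hθ.1).trans hθ.2
  have hm : Measurable fun z : Fin d → ℝ => ∑ i, z i • b i :=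
    Finset.measurable_sum _ fun i _ => by fun_prop
  have hM : Measurable fun x => Real.exp (eigBound C / 2 * logRatio θ x) :=
    Real.measurable_exp.comp ((measurable_logRatio θ).const_mul _)
  have heq : ∀ z : Fin d → ℝ, Real.exp (eigBound C / 2 * logRatio θ (∑ i, z i • b i)) =
      ∏ i, Real.exp (eigBound C / 2 *
        ((Real.log (lam i) - z i ^ 2 + (z i - ⟪b i, θ.1⟫) ^ 2 / lam i) / 2)) := by
    intro z
    rw [show θ = (θ.1, θ.2) from rfl, h.logRatio_eq, Finset.mul_sum, Real.exp_sum]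
    simp [inner_basis_sum]
  have hc := fun i => integral_exp_coordinate (m := ⟪b i, θ.1⟫) (eigBound_pos C)
    (eigBound_le_one hC0) (h.eigBound_le hθ.2 i)
  rw [gaussian_stdParam_eq_map b, integrable_map_measure hM.aestronglyMeasurable hm.aemeasurable,
    integral_map hm.aemeasurable hM.aestronglyMeasurable]
  simp only [Function.comp_def, heq]
  refine ⟨Integrable.fintype_prod_dep fun i => (hc i).1, ?_⟩
  rw [integral_fintype_prod_eq_prod (f := fun i (z : ℝ) => Real.exp (eigBound C / 2 *
        ((Real.log (lam i) - z ^ 2 + (z - ⟪b i, θ.1⟫) ^ 2 / lam i) / 2)))]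
  calc _ ≤ ∏ i, Real.exp (⟪b i, θ.1⟫ ^ 2 + (lam i - 1 - Real.log (lam i))) :=
        Finset.prod_le_prod (fun i _ => integral_nonneg fun z => (Real.exp_pos _).le)
          fun i _ => (hc i).2
    _ = Real.exp (2 * gaussKL (θ.1, θ.2)) := by
        rw [← Real.exp_sum, h.gaussKL_eq, Finset.mul_sum]
        congr 1
        exact Finset.sum_congr rfl fun i _ => by ring
    _ ≤ _ := Real.exp_le_exp.2 (by linarith [hθ.2])

/-- Polynomial tail of the likelihood ratio under `f`, uniformly over `klBall d C`. -/
theorem measureReal_likelihoodRatio_gt_le {C : ℝ} {θ : Param d} (hθ : θ ∈ klBall d C) {a : ℝ}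
    (ha : 0 < a) :
    (gaussian (stdParam d)).real {x | a < Real.exp (logRatio θ x)} ≤
      Real.exp (2 * C) * a ^ (-(eigBound C / 2)) := by
  obtain ⟨h1, h2⟩ := integral_exp_logRatio_le hθ
  have h3 := mul_meas_ge_le_integral_of_nonneg (ae_of_all _ fun x => (Real.exp_pos _).le) h1
    (a ^ (eigBound C / 2))
  have hsub : {x | a < Real.exp (logRatio θ x)} ⊆
      {x | a ^ (eigBound C / 2) ≤ Real.exp (eigBound C / 2 * logRatio θ x)} := by
    intro x hx
    simp only [Set.mem_ofPred_eq] at hx ⊢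
    rw [mul_comm, Real.exp_mul]
    exact Real.rpow_le_rpow ha.le hx.le (by have := eigBound_pos C; positivity)
  have h4 := measureReal_mono (μ := gaussian (stdParam d)) hsub
  have h5 : 0 < a ^ (eigBound C / 2) := Real.rpow_pos_of_pos ha _
  rw [Real.rpow_neg ha.le, ← div_eq_mul_inv, le_div_iff₀ h5, mul_comm]
  exact (mul_le_mul_of_nonneg_left h4 h5.le).trans (h3.trans h2)

end Tail

/-! ### Quantitative laws of large numbers under importance sampling -/

section LLN

theorem integrable_comp_eval {α : Type*} [MeasurableSpace α] {P : Measure α}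
    [IsProbabilityMeasure P] {n : ℕ} {Z : α → ℝ} (hZ : Integrable Z P) (i : Fin n) :
    Integrable (fun y : Fin n → α => Z (y i)) (Measure.pi fun _ => P) :=
  (measurePreserving_eval (fun _ : Fin n => P) i).integrable_comp_of_integrable hZ

theorem integral_pi_eval {α : Type*} [MeasurableSpace α] {P : Measure α}
    [IsProbabilityMeasure P] {n : ℕ} {Z : α → ℝ} (hZ : Integrable Z P) (i : Fin n) :
    ∫ y : Fin n → α, Z (y i) ∂(Measure.pi fun _ => P) = ∫ x, Z x ∂P := by
  have h := (measurePreserving_eval (fun _ : Fin n => P) i)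
  have e := integral_map (f := Z) h.measurable.aemeasurable
    (by rw [h.map_eq]; exact hZ.aestronglyMeasurable)
  rw [h.map_eq] at e
  exact e.symm

theorem integral_abs_le_sqrt {α : Type*} [MeasurableSpace α] {P : Measure α}
    [IsProbabilityMeasure P] {W : α → ℝ} (hW : MemLp W 2 P) :
    ∫ x, |W x| ∂P ≤ Real.sqrt (∫ x, W x ^ 2 ∂P) := by
  apply Real.le_sqrt_of_sq_le
  have h := variance_nonneg (fun x => |W x|) P
  have h2 : MemLp (fun x => |W x|) 2 P := hW.abs
  rw [variance_eq_sub h2] at h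
  simp only [Pi.pow_apply, sq_abs] at h
  linarith

theorem integral_abs_mean_sub_le {α : Type*} [MeasurableSpace α] {P : Measure α}
    [IsProbabilityMeasure P] {n : ℕ} (hn : 0 < n) {Z : α → ℝ} (hZ : MemLp Z 2 P) :
    ∫ y : Fin n → α, |1 / (n : ℝ) * ∑ i, Z (y i) - ∫ x, Z x ∂P| ∂(Measure.pi fun _ => P) ≤
      Real.sqrt ((∫ x, Z x ^ 2 ∂P) / n) := by
  have hn' : (0 : ℝ) < n := by exact_mod_cast hn
  have hev : ∀ i : Fin n, MemLp (fun y : Fin n → α => Z (y i)) 2 (Measure.pi fun _ => P) :=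
    fun i => hZ.comp_measurePreserving (measurePreserving_eval (fun _ : Fin n => P) i)
  have hsum : MemLp (fun y : Fin n → α => ∑ i, Z (y i)) 2 (Measure.pi fun _ => P) :=
    memLp_finsetSum _ fun i _ => hev i
  have hmean : ∫ y : Fin n → α, 1 / (n : ℝ) * ∑ i, Z (y i) ∂(Measure.pi fun _ => P) =
      ∫ x, Z x ∂P := by
    rw [integral_const_mul, integral_finsetSum _ fun i _ =>
      integrable_comp_eval (hZ.integrable (by norm_num)) i]
    simp_rw [integral_pi_eval (hZ.integrable (by norm_num))]
    simp
    field_simp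
  have hW : MemLp (fun y : Fin n → α => 1 / (n : ℝ) * ∑ i, Z (y i)) 2 (Measure.pi fun _ => P) :=
    hsum.const_mul _
  refine (integral_abs_le_sqrt (hW.sub (memLp_const _))).trans (Real.sqrt_le_sqrt ?_)
  have hv : ∫ y : Fin n → α, (1 / (n : ℝ) * ∑ i, Z (y i) - ∫ x, Z x ∂P) ^ 2
      ∂(Measure.pi fun _ => P) = Var[fun y : Fin n → α => 1 / (n : ℝ) * ∑ i, Z (y i);
        Measure.pi fun _ => P] := by
    rw [variance_eq_integral hW.aestronglyMeasurable.aemeasurable, hmean]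
  have hs := variance_sum_pi (μ := fun _ : Fin n => P) (X := fun _ => Z) (fun _ => hZ)
  have hs' : Var[fun y : Fin n → α => ∑ i, Z (y i); Measure.pi fun _ => P] = n * Var[Z; P] := by
    rw [← Finset.sum_fn, hs]
    simp
  change ∫ y : Fin n → α, (1 / (n : ℝ) * ∑ i, Z (y i) - ∫ x, Z x ∂P) ^ 2
      ∂(Measure.pi fun _ => P) ≤ _
  rw [hv, variance_const_mul, hs']
  have h3 : Var[Z; P] ≤ ∫ x, Z x ^ 2 ∂P := by
    simpa using variance_le_expectation_sq hZ.aestronglyMeasurable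
  calc (1 / (n : ℝ)) ^ 2 * (n * Var[Z; P]) = Var[Z; P] / n := by field_simp
    _ ≤ _ := by gcongr

theorem integral_abs_mul_indicator_le {α : Type*} [MeasurableSpace α] {P : Measure α}
    [IsProbabilityMeasure P] {F : α → ℝ} (hF : MemLp F 2 P) {s : Set α} (hs : MeasurableSet s) :
    ∫ x, s.indicator (fun x => |F x|) x ∂P ≤
      Real.sqrt (∫ x, F x ^ 2 ∂P) * Real.sqrt (P.real s) := by
  have h2 : MemLp (s.indicator fun _ => (1 : ℝ)) 2 P := (memLp_const 1).indicator hs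
  have h := integral_mul_le_Lp_mul_Lq_of_nonneg (μ := P) (p := 2) (q := 2)
    (f := fun x => |F x|) (g := s.indicator fun _ => (1 : ℝ)) (by constructor <;> norm_num)
    (ae_of_all _ fun x => abs_nonneg _)
    (ae_of_all _ fun x => Set.indicator_nonneg (fun _ _ => zero_le_one) x)
    (by rw [ENNReal.ofReal_ofNat]; exact hF.abs) (by simpa using h2)
  have e1 : ∀ x, |F x| * s.indicator (fun _ => (1 : ℝ)) x = s.indicator (fun x => |F x|) x := by
    intro x; by_cases hx : x ∈ s <;> simp [hx]
  have e2 : ∀ x, s.indicator (fun _ => (1 : ℝ)) x ^ (2 : ℝ) = s.indicator (fun _ => (1 : ℝ)) x := by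
    intro x; by_cases hx : x ∈ s <;> simp [hx]
  simp only [e1, e2, Real.rpow_two, sq_abs, integral_indicator_const _ hs] at h
  rw [Real.sqrt_eq_rpow, Real.sqrt_eq_rpow]
  simpa using h

variable {d : ℕ}

/-- The weak law of large numbers for importance sampling: truncating the likelihood ratio at
level `a` bounds the mean absolute error by a variance term and a tail term. -/
theorem integral_abs_weighted_mean_sub_le {θ : Param d} (hθ : θ.2.PosDef) {n : ℕ} (hn : 0 < n)
    {a : ℝ} (ha : 0 < a) {F : E d → ℝ} (hFm : Measurable F)
    (hF : MemLp F 2 (gaussian (stdParam d))) :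
    Integrable (fun y : Fin n → E d => 1 / (n : ℝ) * ∑ i, Real.exp (logRatio θ (y i)) * F (y i) -
      ∫ x, F x ∂(gaussian (stdParam d))) (iidGaussian n θ) ∧
    ∫ y, |1 / (n : ℝ) * ∑ i, Real.exp (logRatio θ (y i)) * F (y i) -
      ∫ x, F x ∂(gaussian (stdParam d))| ∂(iidGaussian n θ) ≤
      Real.sqrt (∫ x, F x ^ 2 ∂(gaussian (stdParam d))) *
        (2 * Real.sqrt ((gaussian (stdParam d)).real {x | a < Real.exp (logRatio θ x)}) +
          Real.sqrt (a / n)) := by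
  have hn' : (0 : ℝ) < n := by exact_mod_cast hn
  set s : Set (E d) := {x | a < Real.exp (logRatio θ x)} with hs
  have hsm : MeasurableSet s := measurableSet_lt measurable_const (measurable_exp_logRatio θ)
  have hFi : Integrable F (gaussian (stdParam d)) := hF.integrable (by norm_num)
  have hF2 : Integrable (fun x => F x ^ 2) (gaussian (stdParam d)) := hF.integrable_sq
  -- the truncated part and the remainder
  set Z : E d → ℝ := fun x => Real.exp (logRatio θ x) * sᶜ.indicator F x with hZ
  set R : E d → ℝ := fun x => Real.exp (logRatio θ x) * s.indicator F x with hR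
  have hZi : Integrable Z (gaussian θ) := (integrable_gaussian_mul hθ).2 (hFi.indicator hsm.compl)
  have hRi : Integrable R (gaussian θ) := (integrable_gaussian_mul hθ).2 (hFi.indicator hsm)
  have hadd : ∀ x, Real.exp (logRatio θ x) * F x = Z x + R x := by
    intro x
    by_cases hx : x ∈ s <;> simp [hZ, hR, hx]
  have hmean : ∫ x, F x ∂(gaussian (stdParam d)) =
      ∫ x, Z x ∂(gaussian θ) + ∫ x, R x ∂(gaussian θ) := by
    rw [← integral_gaussian_mul hθ, ← integral_add hZi hRi]
    simp only [hadd]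
  have hZsq_le : ∀ x, Z x ^ 2 ≤ Real.exp (logRatio θ x) * (a * F x ^ 2) := by
    intro x
    by_cases hx : x ∈ s
    · simp [hZ, hx]; positivity
    · have hx' : Real.exp (logRatio θ x) ≤ a := not_lt.1 hx
      have h0 := Real.exp_pos (logRatio θ x)
      simp only [hZ, Set.indicator_of_mem (show x ∈ sᶜ from hx)]
      calc (Real.exp (logRatio θ x) * F x) ^ 2 =
          Real.exp (logRatio θ x) * (Real.exp (logRatio θ x) * F x ^ 2) := by ring
        _ ≤ _ := by gcongr
  have hdom : Integrable (fun x => Real.exp (logRatio θ x) * (a * F x ^ 2)) (gaussian θ) :=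
    (integrable_gaussian_mul hθ).2 (hF2.const_mul a)
  have hZm : Measurable Z := (measurable_exp_logRatio θ).mul (hFm.indicator hsm.compl)
  have hZ2 : MemLp Z 2 (gaussian θ) := by
    rw [memLp_two_iff_integrable_sq hZm.aestronglyMeasurable]
    exact hdom.mono' (hZm.pow_const 2).aestronglyMeasurable
      (ae_of_all _ fun x => by rw [Real.norm_of_nonneg (sq_nonneg _)]; exact hZsq_le x)
  have hZint : ∫ x, Z x ^ 2 ∂(gaussian θ) ≤ a * ∫ x, F x ^ 2 ∂(gaussian (stdParam d)) := by
    calc _ ≤ ∫ x, Real.exp (logRatio θ x) * (a * F x ^ 2) ∂(gaussian θ) :=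
          integral_mono hZ2.integrable_sq hdom hZsq_le
      _ = _ := by rw [integral_gaussian_mul hθ, integral_const_mul]
  have hRabs : ∫ x, |R x| ∂(gaussian θ) ≤ Real.sqrt (∫ x, F x ^ 2 ∂(gaussian (stdParam d))) *
      Real.sqrt ((gaussian (stdParam d)).real s) := by
    have : ∀ x, |R x| = Real.exp (logRatio θ x) * s.indicator (fun x => |F x|) x := by
      intro x
      by_cases hx : x ∈ s <;> simp [hR, hx, abs_mul]
    simp_rw [this]
    rw [integral_gaussian_mul hθ]
    exact integral_abs_mul_indicator_le hF hsm
  have hZl := integral_abs_mean_sub_le hn hZ2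
  have hi1 : Integrable (fun y : Fin n → E d => 1 / (n : ℝ) * ∑ i, Z (y i) -
      ∫ x, Z x ∂(gaussian θ)) (iidGaussian n θ) :=
    ((integrable_finsetSum _ fun i _ => integrable_comp_eval hZi i).const_mul _).sub
      (integrable_const _)
  have hi2 : Integrable (fun y : Fin n → E d => 1 / (n : ℝ) * ∑ i, |R (y i)|)
      (iidGaussian n θ) :=
    (integrable_finsetSum _ fun i _ => integrable_comp_eval hRi.abs i).const_mul _
  have hi3 : Integrable (fun y : Fin n → E d => 1 / (n : ℝ) * ∑ i, R (y i))
      (iidGaussian n θ) :=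
    (integrable_finsetSum _ fun i _ => integrable_comp_eval hRi i).const_mul _
  have hdec : ∀ y : Fin n → E d, 1 / (n : ℝ) * ∑ i, Real.exp (logRatio θ (y i)) * F (y i) -
      ∫ x, F x ∂(gaussian (stdParam d)) = (1 / (n : ℝ) * ∑ i, Z (y i) -
      ∫ x, Z x ∂(gaussian θ)) + (1 / (n : ℝ) * ∑ i, R (y i) - ∫ x, R x ∂(gaussian θ)) := by
    intro y
    rw [hmean]
    simp only [hadd, Finset.sum_add_distrib]
    ring
  have hit : Integrable (fun y : Fin n → E d =>
      1 / (n : ℝ) * ∑ i, Real.exp (logRatio θ (y i)) * F (y i) -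
      ∫ x, F x ∂(gaussian (stdParam d))) (iidGaussian n θ) := by
    simp only [hdec]
    exact hi1.add (hi3.sub (integrable_const _))
  refine ⟨hit, ?_⟩
  have hpt : ∀ y : Fin n → E d, |1 / (n : ℝ) * ∑ i, Real.exp (logRatio θ (y i)) * F (y i) -
      ∫ x, F x ∂(gaussian (stdParam d))| ≤ |1 / (n : ℝ) * ∑ i, Z (y i) -
      ∫ x, Z x ∂(gaussian θ)| + (1 / (n : ℝ) * ∑ i, |R (y i)| + ∫ x, |R x| ∂(gaussian θ)) := by
    intro y
    rw [hdec]
    refine (abs_add_le _ _).trans (add_le_add_right ((abs_sub _ _).trans (add_le_add ?_ ?_)) _)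
    · rw [abs_mul, abs_of_nonneg (by positivity : (0 : ℝ) ≤ 1 / n)]
      gcongr
      exact Finset.abs_sum_le_sum_abs _ _
    · exact abs_integral_le_integral_abs
  have hRsum : ∫ y : Fin n → E d, 1 / (n : ℝ) * ∑ i, |R (y i)| ∂(iidGaussian n θ) =
      ∫ x, |R x| ∂(gaussian θ) := by
    rw [iidGaussian, integral_const_mul,
      integral_finsetSum _ fun i _ => integrable_comp_eval hRi.abs i]
    simp_rw [integral_pi_eval hRi.abs]
    simp
    field_simp
  have hle := integral_mono hit.abs (hi1.abs.add (hi2.add (integrable_const _))) hpt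
  refine hle.trans ?_
  have hsplit : ∫ y : Fin n → E d, (|1 / (n : ℝ) * ∑ i, Z (y i) - ∫ x, Z x ∂(gaussian θ)| +
      (1 / (n : ℝ) * ∑ i, |R (y i)| + ∫ x, |R x| ∂(gaussian θ))) ∂(iidGaussian n θ) =
      ∫ y : Fin n → E d, |1 / (n : ℝ) * ∑ i, Z (y i) - ∫ x, Z x ∂(gaussian θ)| ∂(iidGaussian n θ)
        + (∫ x, |R x| ∂(gaussian θ) + ∫ x, |R x| ∂(gaussian θ)) := by
    have hi4 : Integrable (fun y : Fin n → E d =>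
        1 / (n : ℝ) * ∑ i, |R (y i)| + ∫ x, |R x| ∂(gaussian θ)) (iidGaussian n θ) :=
      hi2.add (integrable_const _)
    rw [integral_add hi1.abs hi4, integral_add hi2 (integrable_const _), hRsum]
    simp
  refine hsplit.le.trans ?_
  have hA : Real.sqrt ((∫ x, Z x ^ 2 ∂(gaussian θ)) / n) ≤
      Real.sqrt (∫ x, F x ^ 2 ∂(gaussian (stdParam d))) * Real.sqrt (a / n) := by
    rw [← Real.sqrt_mul (integral_nonneg fun x => sq_nonneg _)]
    apply Real.sqrt_le_sqrt
    rw [mul_div_assoc', mul_comm]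
    gcongr
  have hZl' : ∫ y : Fin n → E d, |1 / (n : ℝ) * ∑ i, Z (y i) - ∫ x, Z x ∂(gaussian θ)|
    ∂(iidGaussian n θ) ≤ _ := hZl.trans hA
  linarith

/-- The rate exponent of the law of large numbers over `klBall d C`. -/
noncomputable def rateExp (C : ℝ) : ℝ := eigBound C / 8

theorem rateExp_pos (C : ℝ) : 0 < rateExp C := by
  have := eigBound_pos C
  unfold rateExp
  positivity

theorem tail_sqrt_le {C : ℝ} {θ : Param d} (hθ : θ ∈ klBall d C) {n : ℕ} (hn : 0 < n) :
    (gaussian (stdParam d)).real {x | Real.sqrt n < Real.exp (logRatio θ x)} ≤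
      (Real.exp C * (n : ℝ) ^ (-rateExp C)) ^ 2 := by
  have hn' : (0 : ℝ) < n := by exact_mod_cast hn
  refine (measureReal_likelihoodRatio_gt_le hθ (Real.sqrt_pos.2 hn')).trans (le_of_eq ?_)
  rw [mul_pow, ← Real.exp_nat_mul, Real.sqrt_eq_rpow, ← Real.rpow_mul hn'.le,
    ← Real.rpow_mul_natCast hn'.le, rateExp]
  norm_num
  ring_nf

theorem sqrt_sqrt_div_le {C : ℝ} (hC : 0 ≤ C) {n : ℕ} (hn : 0 < n) :
    Real.sqrt (Real.sqrt n / n) ≤ (n : ℝ) ^ (-rateExp C) := by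
  have hn' : (0 : ℝ) < n := by exact_mod_cast hn
  have h : Real.sqrt n / n = (n : ℝ) ^ (-(1 / 2) : ℝ) := by
    rw [Real.sqrt_eq_rpow]
    nth_rw 2 [← Real.rpow_one (n : ℝ)]
    rw [← Real.rpow_sub hn']
    norm_num
  rw [h, Real.sqrt_eq_rpow, ← Real.rpow_mul hn'.le]
  apply Real.rpow_le_rpow_of_exponent_le (by exact_mod_cast hn)
  have := eigBound_le_one hC
  rw [rateExp]
  linarith

/-- Uniform polynomial rate in the law of large numbers over `klBall d C`. -/
theorem integral_abs_weighted_mean_sub_le_rate {C : ℝ} {θ : Param d} (hθ : θ ∈ klBall d C)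
    {n : ℕ} (hn : 0 < n) {F : E d → ℝ} (hFm : Measurable F)
    (hF : MemLp F 2 (gaussian (stdParam d))) {V : ℝ} (hV : 0 ≤ V)
    (hFV : ∫ x, F x ^ 2 ∂(gaussian (stdParam d)) ≤ V ^ 2) :
    ∫⁻ y, ENNReal.ofReal |1 / (n : ℝ) * ∑ i, Real.exp (logRatio θ (y i)) * F (y i) -
      ∫ x, F x ∂(gaussian (stdParam d))| ∂(iidGaussian n θ) ≤
      ENNReal.ofReal (V * ((2 * Real.exp C + 1) * (n : ℝ) ^ (-rateExp C))) := by
  have hn' : (0 : ℝ) < n := by exact_mod_cast hn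
  have hC : 0 ≤ C := (gaussKL_nonneg hθ.1).trans hθ.2
  -- truncation at the level `√n`
  obtain ⟨h1, h2⟩ := integral_abs_weighted_mean_sub_le hθ.1 hn (Real.sqrt_pos.2 hn') hFm hF
  rw [← ofReal_integral_eq_lintegral_ofReal h1.abs (ae_of_all _ fun _ => abs_nonneg _)]
  apply ENNReal.ofReal_le_ofReal
  refine h2.trans ?_
  have h3 : Real.sqrt (∫ x, F x ^ 2 ∂(gaussian (stdParam d))) ≤ V :=
    (Real.sqrt_le_sqrt hFV).trans (Real.sqrt_sq hV).le
  have h4 := (Real.sqrt_le_sqrt (tail_sqrt_le hθ hn)).trans (Real.sqrt_sq (by positivity)).le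
  have h5 := sqrt_sqrt_div_le hC hn
  calc _ ≤ V * (2 * (Real.exp C * (n : ℝ) ^ (-rateExp C)) + (n : ℝ) ^ (-rateExp C)) := by
        gcongr
    _ = _ := by ring

end LLN

/-! ### Efficiency over Kullback–Leibler balls -/

section Efficiency

variable {d : ℕ}

theorem likelihoodRatio_eq {θ : Param d} (hθ : θ.2.PosDef) :
    likelihoodRatio θ = fun x => Real.exp (logRatio θ x) :=
  funext fun x => likelihoodRatio_eq_exp hθ.det_pos x

theorem memLp_two_indicator_one {A : Set (E d)} (hA : MeasurableSet A) :
    MemLp (A.indicator fun _ => (1 : ℝ)) 2 (gaussian (stdParam d)) := (memLp_const 1).indicator hA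

theorem estimatorError_le {C δ : ℝ} (hδ : 0 < δ) {θ : Param d} (hθ : θ ∈ klBall d C)
    {A : Set (E d)} (hA : MeasurableSet A) (hAδ : δ ≤ probF A) {n : ℕ} (hn : 0 < n) :
    estimatorError A n θ ≤
      ENNReal.ofReal (δ⁻¹ * ((2 * Real.exp C + 1) * (n : ℝ) ^ (-rateExp C))) := by
  have hp : 0 < probF A := hδ.trans_le hAδ
  have hsq : ∀ x, A.indicator (fun _ => (1 : ℝ)) x ^ 2 = A.indicator (fun _ => (1 : ℝ)) x := by
    intro x; by_cases hx : x ∈ A <;> simp [hx]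
  have hint : ∫ x, A.indicator (fun _ => (1 : ℝ)) x ∂(gaussian (stdParam d)) = probF A := by
    rw [integral_indicator_const _ hA, smul_eq_mul, mul_one, probF]
  have h := integral_abs_weighted_mean_sub_le_rate hθ hn
    (F := A.indicator fun _ => (1 : ℝ)) (measurable_const.indicator hA)
    (memLp_two_indicator_one hA) zero_le_one (by
      simp only [hsq, hint, one_pow]
      exact measureReal_le_one)
  rw [hint, one_mul] at h
  unfold estimatorError
  rw [ENNReal.ofReal_mul (inv_nonneg.2 hδ.le)]
  refine le_trans ?_ (mul_le_mul_right h (ENNReal.ofReal δ⁻¹))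
  rw [← lintegral_const_mul' _ _ ENNReal.ofReal_ne_top]
  refine lintegral_mono fun y => ?_
  rw [← ENNReal.ofReal_mul (inv_nonneg.2 hδ.le)]
  apply ENNReal.ofReal_le_ofReal
  have e : ∀ x, A.indicator (likelihoodRatio θ) x =
      Real.exp (logRatio θ x) * A.indicator (fun _ => (1 : ℝ)) x := by
    intro x
    rw [likelihoodRatio_eq hθ.1]
    by_cases hx : x ∈ A <;> simp [hx]
  simp only [e]
  have e2 : 1 / (probF A * n) * ∑ i, Real.exp (logRatio θ (y i)) *
      A.indicator (fun _ => (1 : ℝ)) (y i) - 1 = (probF A)⁻¹ * (1 / (n : ℝ) *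
        ∑ i, Real.exp (logRatio θ (y i)) * A.indicator (fun _ => (1 : ℝ)) (y i) - probF A) := by
    field_simp
  rw [e2, abs_mul, abs_of_pos (inv_pos.2 hp)]
  gcongr

/-- The largest weight is at most the level `a` plus the sum of the weights above `a`; the second
term on the right takes over when the sum of the weights is less than half its mean `n`. -/
theorem max_div_sum_le {n : ℕ} (hn : 0 < n) (w : Fin n → ℝ) (hw : ∀ i, 0 < w i) {a : ℝ}
    (ha : 0 ≤ a) :
    (⨆ i, w i) / ∑ i, w i ≤ 2 / n * (a + ∑ i, w i * (Set.Ioi a).indicator (fun _ => 1) (w i)) +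
      2 * |1 / (n : ℝ) * ∑ i, w i - 1| := by
  have : Nonempty (Fin n) := ⟨⟨0, hn⟩⟩
  have hn' : (0 : ℝ) < n := by exact_mod_cast hn
  have hS : 0 < ∑ i, w i := Finset.sum_pos (fun i _ => hw i) Finset.univ_nonempty
  have hI : ∀ i, 0 ≤ w i * (Set.Ioi a).indicator (fun _ => (1 : ℝ)) (w i) := fun i =>
    mul_nonneg (hw i).le (Set.indicator_nonneg (fun _ _ => zero_le_one) _)
  have hmax1 : (⨆ i, w i) ≤ ∑ i, w i := ciSup_le fun i =>
    Finset.single_le_sum (fun j _ => (hw j).le) (Finset.mem_univ i)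
  have hmax2 : (⨆ i, w i) ≤ a + ∑ i, w i * (Set.Ioi a).indicator (fun _ => 1) (w i) := by
    refine ciSup_le fun i => ?_
    have h1 := Finset.single_le_sum (fun j _ => hI j) (Finset.mem_univ i)
    rcases le_or_gt (w i) a with h | h
    · have := Finset.sum_nonneg fun j (_ : j ∈ Finset.univ) => hI j
      linarith
    · rw [Set.indicator_of_mem (Set.mem_Ioi.2 h), mul_one] at h1
      linarith
  have hR : 0 ≤ a + ∑ i, w i * (Set.Ioi a).indicator (fun _ => 1) (w i) :=
    add_nonneg ha (Finset.sum_nonneg fun j _ => hI j)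
  rcases le_or_gt ((n : ℝ) / 2) (∑ i, w i) with h | h
  · have h1 : (⨆ i, w i) / ∑ i, w i ≤
        (a + ∑ i, w i * (Set.Ioi a).indicator (fun _ => 1) (w i)) / (n / 2) := by
      gcongr
    have h2 : (a + ∑ i, w i * (Set.Ioi a).indicator (fun _ => 1) (w i)) / (n / 2 : ℝ) =
        2 / n * (a + ∑ i, w i * (Set.Ioi a).indicator (fun _ => 1) (w i)) := by
      field_simp
    have h3 := abs_nonneg (1 / (n : ℝ) * ∑ i, w i - 1)
    linarith
  · have h1 : (⨆ i, w i) / ∑ i, w i ≤ 1 := (div_le_one hS).2 hmax1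
    have h2 : 1 / (n : ℝ) * ∑ i, w i ≤ 1 / 2 := by
      rw [one_div, inv_mul_le_iff₀ hn']
      linarith
    have h3 := neg_abs_le (1 / (n : ℝ) * ∑ i, w i - 1)
    have h4 : 0 ≤ 2 / (n : ℝ) * (a + ∑ i, w i * (Set.Ioi a).indicator (fun _ => 1) (w i)) := by
      positivity
    linarith

theorem lintegral_sum_eval {α : Type*} [MeasurableSpace α] {P : Measure α}
    [IsProbabilityMeasure P] {n : ℕ} {G : α → ℝ≥0∞} (hG : Measurable G) :
    ∫⁻ y : Fin n → α, ∑ i, G (y i) ∂(Measure.pi fun _ => P) = n * ∫⁻ x, G x ∂P := by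
  have hGi : ∀ i : Fin n, Measurable fun y : Fin n → α => G (y i) := fun i =>
    hG.comp (measurable_pi_apply i)
  rw [lintegral_finsetSum _ fun i _ => hGi i]
  have : ∀ i : Fin n, ∫⁻ y : Fin n → α, G (y i) ∂(Measure.pi fun _ => P) = ∫⁻ x, G x ∂P := by
    intro i
    have h := measurePreserving_eval (fun _ : Fin n => P) i
    conv_rhs => rw [← h.map_eq]
    exact (lintegral_map hG h.measurable).symm
  simp [this]

theorem maxWeightRatio_le {C : ℝ} {θ : Param d} (hθ : θ ∈ klBall d C) {n : ℕ} (hn : 0 < n) :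
    maxWeightRatio n θ ≤ ENNReal.ofReal
      ((4 + 4 * Real.exp C + 2 * Real.exp (2 * C)) * (n : ℝ) ^ (-rateExp C)) := by
  have hn' : (0 : ℝ) < n := by exact_mod_cast hn
  have hC : 0 ≤ C := (gaussKL_nonneg hθ.1).trans hθ.2
  set r : ℝ := (n : ℝ) ^ (-rateExp C) with hr
  have hr0 : 0 ≤ r := by positivity
  have hr1 : r ≤ 1 := by
    rw [hr]
    exact Real.rpow_le_one_of_one_le_of_nonpos (by exact_mod_cast hn)
      (by linarith [rateExp_pos C])
  have hLLN := integral_abs_weighted_mean_sub_le_rate hθ hn (F := fun _ => (1 : ℝ))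
    measurable_const (memLp_const 1) zero_le_one (by simp)
  simp only [mul_one, integral_const, probReal_univ, smul_eq_mul, one_mul] at hLLN
  set I : E d → ℝ := fun x =>
    (Set.Ioi (Real.sqrt n)).indicator (fun _ => (1 : ℝ)) (Real.exp (logRatio θ x)) with hI
  have hIm : Measurable I := (measurable_const.indicator measurableSet_Ioi).comp
    (measurable_exp_logRatio θ)
  have hI0 : ∀ x, 0 ≤ I x := fun x => Set.indicator_nonneg (fun _ _ => zero_le_one) _
  have hIint : ∫⁻ x, ENNReal.ofReal (Real.exp (logRatio θ x) * I x) ∂(gaussian θ) ≤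
      ENNReal.ofReal (Real.exp (2 * C) * r) := by
    have e : ∀ x, ENNReal.ofReal (Real.exp (logRatio θ x) * I x) =
        ENNReal.ofReal (Real.exp (logRatio θ x)) * ENNReal.ofReal (I x) := fun x =>
      ENNReal.ofReal_mul (Real.exp_pos _).le
    simp_rw [e]
    rw [lintegral_gaussian_mul hθ.1 hIm.ennreal_ofReal]
    have : ∀ x, ENNReal.ofReal (I x) =
        {x | Real.sqrt n < Real.exp (logRatio θ x)}.indicator 1 x := by
      intro x
      by_cases hx : Real.sqrt n < Real.exp (logRatio θ x) <;> simp [hI, Set.indicator, hx]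
    simp_rw [this]
    rw [lintegral_indicator_one (measurableSet_lt measurable_const (measurable_exp_logRatio θ)),
      ← ofReal_measureReal (measure_ne_top _ _)]
    apply ENNReal.ofReal_le_ofReal
    refine (tail_sqrt_le hθ hn).trans ?_
    rw [mul_pow, ← Real.exp_nat_mul]
    push_cast
    gcongr
    nlinarith
  have hsq : Real.sqrt n / n ≤ r := by
    have h1 := sqrt_sqrt_div_le hC hn
    have h2 : 0 ≤ Real.sqrt n / n := by positivity
    have h3 : Real.sqrt n / n = Real.sqrt (Real.sqrt n / n) ^ 2 := (Real.sq_sqrt h2).symm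
    rw [h3]
    calc _ ≤ r ^ 2 := by gcongr
      _ ≤ r := by nlinarith
  have hpt : ∀ y : Fin n → E d, ENNReal.ofReal
      ((⨆ i, likelihoodRatio θ (y i)) / ∑ i, likelihoodRatio θ (y i)) ≤
      ENNReal.ofReal (2 * r) + (ENNReal.ofReal (2 / n) *
        ∑ i, ENNReal.ofReal (Real.exp (logRatio θ (y i)) * I (y i)) +
      ENNReal.ofReal 2 *
        ENNReal.ofReal |1 / (n : ℝ) * ∑ i, Real.exp (logRatio θ (y i)) - 1|) := by
    intro y
    rw [← ENNReal.ofReal_sum_of_nonneg fun i _ => mul_nonneg (Real.exp_pos _).le (hI0 _),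
      ← ENNReal.ofReal_mul (by positivity), ← ENNReal.ofReal_mul (by positivity),
      ← ENNReal.ofReal_add (mul_nonneg (by positivity) (Finset.sum_nonneg fun i _ =>
        mul_nonneg (Real.exp_pos _).le (hI0 _))) (by positivity),
      ← ENNReal.ofReal_add (by positivity) (add_nonneg (mul_nonneg (by positivity)
        (Finset.sum_nonneg fun i _ => mul_nonneg (Real.exp_pos _).le (hI0 _))) (by positivity))]
    apply ENNReal.ofReal_le_ofReal
    rw [likelihoodRatio_eq hθ.1]
    refine (max_div_sum_le hn (fun i => Real.exp (logRatio θ (y i))) (fun i => Real.exp_pos _)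
      (Real.sqrt_nonneg n)).trans ?_
    rw [mul_add, div_mul_eq_mul_div, mul_div_assoc, add_assoc]
    gcongr
  calc maxWeightRatio n θ ≤ ∫⁻ y, (ENNReal.ofReal (2 * r) + (ENNReal.ofReal (2 / n) *
        ∑ i, ENNReal.ofReal (Real.exp (logRatio θ (y i)) * I (y i)) +
      ENNReal.ofReal 2 *
        ENNReal.ofReal |1 / (n : ℝ) * ∑ i, Real.exp (logRatio θ (y i)) - 1|))
        ∂(iidGaussian n θ) := lintegral_mono hpt
    _ ≤ ENNReal.ofReal (2 * r) + (ENNReal.ofReal (2 / n) *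
          (n * ENNReal.ofReal (Real.exp (2 * C) * r)) +
        ENNReal.ofReal 2 * ENNReal.ofReal ((2 * Real.exp C + 1) * r)) := by
        have hm : Measurable fun x => ENNReal.ofReal (Real.exp (logRatio θ x) * I x) :=
          ((measurable_exp_logRatio θ).mul hIm).ennreal_ofReal
        have hms : Measurable fun y : Fin n → E d =>
            ∑ i, ENNReal.ofReal (Real.exp (logRatio θ (y i)) * I (y i)) :=
          Finset.measurable_sum _ fun i _ => hm.comp (measurable_pi_apply i)
        rw [lintegral_add_left measurable_const, lintegral_add_left (hms.const_mul _),
          lintegral_const_mul _ hms, lintegral_const_mul' _ _ ENNReal.ofReal_ne_top, iidGaussian,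
          lintegral_sum_eval hm]
        simp only [lintegral_const, measure_univ, mul_one]
        gcongr
        exact hLLN
    _ = _ := by
        rw [← ENNReal.ofReal_natCast n, ← ENNReal.ofReal_mul (by positivity),
          ← ENNReal.ofReal_mul (by positivity), ← ENNReal.ofReal_mul (by positivity),
          ← ENNReal.ofReal_add (by positivity) (by positivity),
          ← ENNReal.ofReal_add (by positivity) (by positivity)]
        congr 1
        field_simp
        ring

theorem measurable_lintegral_iidGaussian {n : ℕ} {G : Param d → (Fin n → E d) → ℝ≥0∞}
    (hG : Measurable (Function.uncurry G)) :
    Measurable fun θ => ∫⁻ y, G θ y ∂(iidGaussian n θ) := by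
  have h1 : ∀ θ : Param d, Measurable fun (z : Fin n → E d) i => affineMap θ (z i) := fun θ =>
    measurable_affine_sample measurable_const measurable_id
  have h2 : ∀ θ : Param d, ∫⁻ y, G θ y ∂(iidGaussian n θ) =
      ∫⁻ z, G θ (fun i => affineMap θ (z i)) ∂(Measure.pi fun _ : Fin n => stdGaussian (E d)) := by
    intro θ
    have h3 : Measurable (G θ) := hG.comp measurable_prodMk_left
    rw [iidGaussian_eq_map, lintegral_map h3 (h1 θ)]
  simp_rw [h2]
  exact Measurable.lintegral_prod_right' (f := fun p : Param d × (Fin n → E d) =>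
    G p.1 fun i => affineMap p.1 (p.2 i))
    (hG.comp (measurable_fst.prodMk (measurable_affine_sample measurable_fst measurable_snd)))

theorem measurable_likelihoodRatio_eval {n : ℕ} (i : Fin n) :
    Measurable fun p : Param d × (Fin n → E d) => likelihoodRatio p.1 (p.2 i) :=
  measurable_likelihoodRatio measurable_fst ((measurable_pi_apply i).comp measurable_snd)

theorem measurable_maxWeightRatio (n : ℕ) :
    Measurable (maxWeightRatio n : Param d → ℝ≥0∞) := by
  refine measurable_lintegral_iidGaussian (G := fun θ y => ENNReal.ofReal
    ((⨆ i, likelihoodRatio θ (y i)) / ∑ i, likelihoodRatio θ (y i))) ?_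
  exact ((Measurable.iSup fun i => measurable_likelihoodRatio_eval i).div
    (Finset.measurable_sum _ fun i _ => measurable_likelihoodRatio_eval i)).ennreal_ofReal

theorem measurable_estimatorError {A : Set (E d)} (hA : MeasurableSet A) (n : ℕ) :
    Measurable (estimatorError A n : Param d → ℝ≥0∞) := by
  refine measurable_lintegral_iidGaussian (G := fun θ y => ENNReal.ofReal
    |1 / (probF A * n) * ∑ i, A.indicator (likelihoodRatio θ) (y i) - 1|) ?_
  have h : ∀ i : Fin n, Measurable fun p : Param d × (Fin n → E d) =>
      A.indicator (likelihoodRatio p.1) (p.2 i) := by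
    intro i
    have : (fun p : Param d × (Fin n → E d) => A.indicator (likelihoodRatio p.1) (p.2 i)) =
        {p : Param d × (Fin n → E d) | p.2 i ∈ A}.indicator
          fun p => likelihoodRatio p.1 (p.2 i) := by
      ext p
      by_cases hp : p.2 i ∈ A <;> simp [Set.indicator, hp]
    rw [this]
    exact (measurable_likelihoodRatio_eval i).indicator
      (((measurable_pi_apply i).comp measurable_snd) hA)
  have h2 : Measurable fun p : Param d × (Fin n → E d) =>
      1 / (probF A * n) * ∑ i, A.indicator (likelihoodRatio p.1) (p.2 i) - 1 :=
    ((Finset.measurable_sum _ fun i _ => h i).const_mul _).sub_const _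
  exact (continuous_abs.measurable.comp h2).ennreal_ofReal

/-- Convergence in probability to `0` of random variables defined on different probability spaces
implies convergence in distribution to `0`. -/
theorem tendstoInDistribution_zero {Ω : ℕ+ → Type} [∀ d, MeasurableSpace (Ω d)]
    (P : ∀ d, Measure (Ω d)) [∀ d, IsProbabilityMeasure (P d)] {X : ∀ d, Ω d → ℝ≥0∞}
    (hX : ∀ d, AEMeasurable (X d) (P d))
    (h : ∀ ε : ℝ≥0∞, 0 < ε → Tendsto (fun d => P d {ω | ε ≤ X d ω}) atTop (𝓝 0)) :
    TendstoInDistribution X atTop (fun _ : Unit => (0 : ℝ≥0∞)) P (Measure.dirac ()) where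
  forall_aemeasurable := hX
  aemeasurable_limit := measurable_const.aemeasurable
  tendsto := by
    refine ProbabilityMeasure.tendsto_iff_forall_integral_tendsto.2 fun F => ?_
    have hF : ∀ (Q : Measure ℝ≥0∞), AEStronglyMeasurable F Q := fun Q =>
      F.continuous.measurable.aestronglyMeasurable
    change Tendsto (fun d => ∫ x, F x ∂((P d).map (X d))) atTop
      (𝓝 (∫ x, F x ∂((Measure.dirac ()).map fun _ => (0 : ℝ≥0∞))))
    rw [integral_map measurable_const.aemeasurable (hF _), integral_dirac]
    simp_rw [fun d => integral_map (hX d) (hF _)]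
    rw [Metric.tendsto_nhds]
    intro η hη
    have hcont := F.continuous.tendsto 0
    rw [Metric.tendsto_nhds] at hcont
    have hev := hcont (η / 2) (by positivity)
    rw [ENNReal.nhds_zero_basis.eventually_iff] at hev
    obtain ⟨ε, hε, hεF⟩ := hev
    have hb : 0 < 2 * ‖F‖ + 1 := by positivity
    have h1 := (ENNReal.tendsto_toReal ENNReal.zero_ne_top).comp (h ε hε)
    have h2 := (tendsto_order.1 h1).2 (η / 2 / (2 * ‖F‖ + 1)) (by
      rw [ENNReal.toReal_zero]; positivity)
    filter_upwards [h2] with d hd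
    rw [Function.comp_apply, lt_div_iff₀ hb] at hd
    set s : Set (Ω d) := {ω | ε ≤ X d ω} with hs
    have hsm : NullMeasurableSet s (P d) := nullMeasurableSet_le aemeasurable_const (hX d)
    have hFX : Integrable (fun ω => F (X d ω)) (P d) :=
      Integrable.of_bound (F.continuous.measurable.comp_aemeasurable (hX d)).aestronglyMeasurable
        ‖F‖ (ae_of_all _ fun ω => F.norm_coe_le_norm _)
    have hdom : Integrable (fun ω => η / 2 + s.indicator (fun _ => 2 * ‖F‖) ω) (P d) :=
      (integrable_const _).add ((integrable_const _).indicator₀ hsm)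
    have hpt : ∀ ω, ‖F (X d ω) - F 0‖ ≤ η / 2 + s.indicator (fun _ => 2 * ‖F‖) ω := by
      intro ω
      by_cases hω : ω ∈ s
      · rw [Set.indicator_of_mem hω]
        have := norm_sub_le (F (X d ω)) (F 0)
        linarith [F.norm_coe_le_norm (X d ω), F.norm_coe_le_norm 0]
      · rw [Set.indicator_of_notMem hω, add_zero, ← dist_eq_norm]
        exact (hεF (Set.mem_Iio.2 (not_le.1 (show ¬ ε ≤ X d ω from hω)))).le
    calc dist (∫ ω, F (X d ω) ∂(P d)) (F 0) = ‖∫ ω, (F (X d ω) - F 0) ∂(P d)‖ := by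
          rw [integral_sub hFX (integrable_const _), dist_eq_norm]
          simp
      _ ≤ ∫ ω, (η / 2 + s.indicator (fun _ => 2 * ‖F‖) ω) ∂(P d) :=
          norm_integral_le_of_norm_le hdom (ae_of_all _ hpt)
      _ = η / 2 + 2 * ‖F‖ * (P d).real s := by
          rw [integral_add (integrable_const _) ((integrable_const _).indicator₀ hsm),
            integral_indicator₀ hsm]
          simp [mul_comm]
      _ < η := by
          have h0 : 0 ≤ (P d).real s := measureReal_nonneg
          change (P d).real s * _ < _ at hd
          nlinarith

theorem tendsto_rate {C : ℝ} (K : ℝ) {n : ℕ+ → ℕ} (hn : Tendsto n atTop atTop) :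
    Tendsto (fun d => ENNReal.ofReal (K * (n d : ℝ) ^ (-rateExp C))) atTop (𝓝 0) := by
  have h1 := (tendsto_rpow_neg_atTop (rateExp_pos C)).comp
    (tendsto_natCast_atTop_atTop (R := ℝ) |>.comp hn)
  have h2 := ENNReal.tendsto_ofReal (h1.const_mul K)
  simpa using h2

/-- A sequence of random Gaussian parameters that lie, with probability tending to one, at bounded
Kullback–Leibler divergence from `N(0, I)` is efficient for sets of probability bounded below. -/
theorem efficientInHighDim_of_klBall {Ω : ℕ+ → Type} [∀ d, MeasurableSpace (Ω d)]
    (P : ∀ d, Measure (Ω d)) [∀ d, IsProbabilityMeasure (P d)]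
    (θ : ∀ d : ℕ+, Ω d → Param d) (A : ∀ d : ℕ+, Set (E d)) (hθ : ∀ d, Measurable (θ d))
    (hA : ∀ d, MeasurableSet (A d)) {δ : ℝ} (hδ : 0 < δ) (hAδ : ∀ d, δ ≤ probF (A d)) (C : ℝ)
    (hP : Tendsto (fun d => P d {ω | θ d ω ∉ klBall d C}) atTop (𝓝 0)) :
    EfficientInHighDim P θ A := by
  intro np hnp
  have key : ∀ (Y : ∀ d : ℕ+, Param d → ℝ≥0∞) (K : ℝ),
      (∀ d, 0 < np d → ∀ ϑ ∈ klBall d C,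
        Y d ϑ ≤ ENNReal.ofReal (K * (np d : ℝ) ^ (-rateExp C))) →
      ∀ ε : ℝ≥0∞, 0 < ε → Tendsto (fun d => P d {ω | ε ≤ Y d (θ d ω)}) atTop (𝓝 0) := by
    intro Y K hY ε hε
    refine tendsto_of_tendsto_of_tendsto_of_le_of_le' tendsto_const_nhds hP
      (Eventually.of_forall fun _ => bot_le) ?_
    filter_upwards [(tendsto_order.1 (tendsto_rate (C := C) K hnp)).2 ε hε,
      hnp.eventually_gt_atTop 0] with d hd hd0
    refine measure_mono fun ω hω hmem => ?_
    exact absurd ((hω.trans (hY d hd0 _ hmem)).trans_lt hd) (lt_irrefl _)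
  exact ⟨tendstoInDistribution_zero P
      (fun d => ((measurable_maxWeightRatio _).comp (hθ d)).aemeasurable)
      (key _ _ fun d hd ϑ hϑ => maxWeightRatio_le hϑ hd),
    tendstoInDistribution_zero P
      (fun d => ((measurable_estimatorError (hA d) _).comp (hθ d)).aemeasurable)
      (key _ (δ⁻¹ * (2 * Real.exp C + 1)) fun d hd ϑ hϑ => by
        rw [mul_assoc]; exact estimatorError_le hδ hϑ (hA d) (hAδ d) hd)⟩

end Efficiency

/-! ### Entropy inequalities -/

section Entropy

variable {d : ℕ} {S : Matrix (Fin d) (Fin d) ℝ} {b : OrthonormalBasis (Fin d) ℝ (E d)}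
  {lam : Fin d → ℝ}

theorem exp_integral_le_of_lintegral_le {α : Type*} [MeasurableSpace α] {P : Measure α}
    [IsProbabilityMeasure P] {h : α → ℝ} (hi : Integrable h P) {M : ℝ} (hM : 0 ≤ M)
    (hle : ∫⁻ x, ENNReal.ofReal (Real.exp (h x)) ∂P ≤ ENNReal.ofReal M) :
    Real.exp (∫ x, h x ∂P) ≤ M := by
  have hm : AEStronglyMeasurable (fun x => Real.exp (h x)) P :=
    Real.continuous_exp.comp_aestronglyMeasurable hi.aestronglyMeasurable
  have he : Integrable (fun x => Real.exp (h x)) P := by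
    refine ⟨hm, ?_⟩
    rw [hasFiniteIntegral_iff_ofReal (ae_of_all _ fun _ => (Real.exp_pos _).le)]
    exact hle.trans_lt ENNReal.ofReal_lt_top
  have h1 := convexOn_exp.map_integral_le (μ := P) (f := h) Real.continuous_exp.continuousOn
    isClosed_univ (ae_of_all _ fun _ => Set.mem_univ _) hi he
  refine h1.trans ?_
  rw [integral_eq_lintegral_of_nonneg_ae (ae_of_all _ fun _ => (Real.exp_pos _).le) hm]
  exact ENNReal.toReal_le_of_le_ofReal hM hle

theorem memLp_inner {ν : Measure (E d)} (hν : MemLp id 2 ν) (v : E d) :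
    MemLp (fun x => ⟪v, x⟫) 2 ν := hν.const_inner v

theorem integral_sub_sq {α : Type*} [MeasurableSpace α] {P : Measure α} [IsProbabilityMeasure P]
    {X : α → ℝ} (hX : MemLp X 2 P) (m : ℝ) :
    Integrable (fun x => (X x - m) ^ 2) P ∧
      ∫ x, (X x - m) ^ 2 ∂P = Var[X; P] + (∫ x, X x ∂P - m) ^ 2 := by
  have h1 : MemLp (fun x => X x - m) 2 P := hX.sub (memLp_const m)
  refine ⟨h1.integrable_sq, ?_⟩
  have h2 := variance_eq_sub h1
  rw [variance_sub_const hX.aestronglyMeasurable] at h2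
  simp only [Pi.pow_apply] at h2
  rw [integral_sub (hX.integrable (by norm_num)) (integrable_const _)] at h2
  simp at h2
  linarith

/-- The mean of `log (f / g)` under a measure `ν` depends on `ν` only through the means and
variances of the coordinates in an eigenbasis of the covariance matrix of `g`. -/
theorem Diagonalizes.integral_logRatio (h : Diagonalizes S b lam) (μ : E d) {ν : Measure (E d)}
    [IsProbabilityMeasure ν] (hν : MemLp id 2 ν) :
    Integrable (logRatio (μ, S)) ν ∧ ∫ x, logRatio (μ, S) x ∂ν =
      ∑ i, (Real.log (lam i) - (Var[fun x => ⟪b i, x⟫; ν] + (∫ x, ⟪b i, x⟫ ∂ν) ^ 2) +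
        (Var[fun x => ⟪b i, x⟫; ν] + (∫ x, ⟪b i, x⟫ ∂ν - ⟪b i, μ⟫) ^ 2) / lam i) / 2 := by
  have h0 := fun i => integral_sub_sq (memLp_inner hν (b i)) 0
  have hm := fun i => integral_sub_sq (memLp_inner hν (b i)) ⟪b i, μ⟫
  simp only [sub_zero] at h0
  have hi : ∀ i, Integrable (fun x => (Real.log (lam i) - ⟪b i, x⟫ ^ 2 +
      (⟪b i, x⟫ - ⟪b i, μ⟫) ^ 2 / lam i) / 2) ν := fun i =>
    (((integrable_const _).sub (h0 i).1).add ((hm i).1.div_const _)).div_const _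
  have heq : logRatio (μ, S) = fun x => ∑ i, (Real.log (lam i) - ⟪b i, x⟫ ^ 2 +
      (⟪b i, x⟫ - ⟪b i, μ⟫) ^ 2 / lam i) / 2 := funext fun x => h.logRatio_eq x
  rw [heq]
  refine ⟨integrable_finsetSum _ fun i _ => hi i, ?_⟩
  rw [integral_finsetSum _ fun i _ => hi i]
  refine Finset.sum_congr rfl fun i _ => ?_
  have hA : Integrable (fun x => Real.log (lam i) - ⟪b i, x⟫ ^ 2) ν :=
    (integrable_const _).sub (h0 i).1
  rw [integral_div, integral_add hA ((hm i).1.div_const _), integral_div,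
    integral_sub (integrable_const _) (h0 i).1, (h0 i).2, (hm i).2]
  simp

theorem memLp_id_gaussian (θ : Param d) : MemLp id 2 (gaussian θ) := by
  unfold gaussian; exact IsGaussian.memLp_two_id

theorem integral_inner {ν : Measure (E d)} [IsProbabilityMeasure ν] (hν : MemLp id 2 ν) (v : E d) :
    ∫ x, ⟪v, x⟫ ∂ν = ⟪v, ∫ x, x ∂ν⟫ :=
  _root_.integral_inner (hν.integrable (by norm_num)) v

theorem integral_logRatio_gaussian {θ : Param d} (hθ : θ.2.PosDef) :
    Integrable (logRatio θ) (gaussian θ) ∧ ∫ x, logRatio θ x ∂(gaussian θ) = -gaussKL θ := by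
  obtain ⟨b, lam, h⟩ := exists_diagonalizes hθ
  obtain ⟨h1, h2⟩ := h.integral_logRatio θ.1 (memLp_id_gaussian θ)
  refine ⟨h1, h2.trans ?_⟩
  have hvar : ∀ i, Var[fun x => ⟪b i, x⟫; gaussian θ] = lam i := by
    intro i
    rw [← covarianceBilin_self (memLp_id_gaussian θ), gaussian,
      covarianceBilin_multivariateGaussian hθ.posSemidef, h.quadForm_basis]
  have hmean : ∀ i, ∫ x, ⟪b i, x⟫ ∂(gaussian θ) = ⟪b i, θ.1⟫ := by
    intro i
    rw [integral_inner (memLp_id_gaussian θ), gaussian, integral_id_multivariateGaussian]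
  rw [show θ = (θ.1, θ.2) from rfl, h.gaussKL_eq, ← Finset.sum_neg_distrib]
  refine Finset.sum_congr rfl fun i _ => ?_
  have := (h.pos i).ne'
  rw [← show θ = (θ.1, θ.2) from rfl, hvar, hmean]
  field_simp
  ring

/-- A set charged by `g` is charged by `f`, quantitatively in terms of the Kullback–Leibler
divergence of `g` with respect to `f`. -/
theorem exp_le_probF {C ρ : ℝ} (hρ : 0 < ρ) {θ : Param d} (hθ : θ ∈ klBall d C) {A : Set (E d)}
    (hA : MeasurableSet A) (hAρ : ρ ≤ (gaussian θ).real A) :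
    Real.exp (-(C + Real.log 2) / ρ) ≤ probF A := by
  have hC : 0 ≤ C := (gaussKL_nonneg hθ.1).trans hθ.2
  have hp : 0 < probF A := by
    rw [probF, measureReal_def, ENNReal.toReal_pos_iff]
    refine ⟨pos_iff_ne_zero.2 fun h0 => ?_, measure_lt_top _ _⟩
    have := gaussian_absolutelyContinuous hθ.1 h0
    rw [measureReal_def, this] at hAρ
    simp at hAρ
    linarith
  have hp1 : probF A ≤ 1 := measureReal_le_one
  set s : ℝ := -Real.log (probF A) with hs
  have hs0 : 0 ≤ s := by
    have := Real.log_nonpos hp.le hp1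
    linarith
  have hes : Real.exp s = (probF A)⁻¹ := by rw [hs, Real.exp_neg, Real.exp_log hp]
  obtain ⟨h1, h2⟩ := integral_logRatio_gaussian hθ.1
  have hAi : Integrable (fun x => A.indicator (fun _ => s) x) (gaussian θ) :=
    (integrable_const _).indicator hA
  -- under `f`, the function `exp (s 1_A)` with `exp s = 1 / p_f(A)` has integral `2 - p_f(A)`
  have hlin : ∫⁻ x, ENNReal.ofReal (Real.exp (logRatio θ x + A.indicator (fun _ => s) x))
      ∂(gaussian θ) ≤ ENNReal.ofReal 2 := by
    have hm : Measurable fun x => ENNReal.ofReal (Real.exp (A.indicator (fun _ => s) x)) :=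
      (Real.measurable_exp.comp (measurable_const.indicator hA)).ennreal_ofReal
    have e1 : ∀ x, ENNReal.ofReal (Real.exp (logRatio θ x + A.indicator (fun _ => s) x)) =
        ENNReal.ofReal (Real.exp (logRatio θ x)) *
          ENNReal.ofReal (Real.exp (A.indicator (fun _ => s) x)) := fun x => by
      rw [Real.exp_add, ENNReal.ofReal_mul (Real.exp_pos _).le]
    simp_rw [e1]
    rw [lintegral_gaussian_mul hθ.1 hm]
    calc _ ≤ ∫⁻ x, (1 + A.indicator (fun _ => ENNReal.ofReal (probF A)⁻¹) x)
          ∂(gaussian (stdParam d)) := by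
          refine lintegral_mono fun x => ?_
          by_cases hx : x ∈ A
          · simp only [Set.indicator_of_mem hx, hes]
            exact le_add_self
          · simp [hx]
      _ = ENNReal.ofReal 2 := by
          rw [lintegral_add_left measurable_const, lintegral_indicator_const hA,
            ← ofReal_measureReal (measure_ne_top _ _), ← ENNReal.ofReal_mul (by positivity),
            ← probF, inv_mul_cancel₀ hp.ne']
          simp
          norm_num
  have hJ := exp_integral_le_of_lintegral_le (h1.add hAi) zero_le_two hlin
  simp only [Pi.add_apply] at hJ
  rw [integral_add h1 hAi, h2, integral_indicator_const _ hA, smul_eq_mul,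
    ← Real.le_log_iff_exp_le two_pos] at hJ
  rw [← Real.le_log_iff_exp_le hp, div_le_iff₀ hρ]
  have : ρ * s ≤ (gaussian θ).real A * s := mul_le_mul_of_nonneg_right hAρ hs0
  have h3 := hθ.2
  have h4 : Real.log (probF A) = -s := by rw [hs, neg_neg]
  rw [h4]
  linarith

variable {B : Set (E d)}

theorem measure_ne_zero_of_probF_pos (hB : 0 < probF B) : gaussian (stdParam d) B ≠ 0 := by
  intro h
  rw [probF, measureReal_def, h] at hB
  simp at hB

theorem memLp_id_cond (hB : 0 < probF B) : MemLp id 2 ((gaussian (stdParam d))[|B]) := by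
  rw [ProbabilityTheory.cond]
  exact (memLp_id_gaussian _).restrict B |>.smul_measure
    (ENNReal.inv_ne_top.2 (measure_ne_zero_of_probF_pos hB))

/-- Jensen's inequality: conditioning `f` on `B` raises the mean of `log (g / f)` to at most
`log (1 / p_f(B))`. -/
theorem integral_neg_logRatio_cond_le {θ : Param d} (hθ : θ.2.PosDef) (hB : 0 < probF B) :
    -∫ x, logRatio θ x ∂((gaussian (stdParam d))[|B]) ≤ -Real.log (probF B) := by
  have hne := measure_ne_zero_of_probF_pos hB
  have := cond_isProbabilityMeasure hne
  obtain ⟨b, lam, h⟩ := exists_diagonalizes hθ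
  have hi : Integrable (fun x => -logRatio θ x) ((gaussian (stdParam d))[|B]) :=
    (h.integral_logRatio θ.1 (memLp_id_cond hB)).1.neg
  have hle : ∫⁻ x, ENNReal.ofReal (Real.exp (-logRatio θ x)) ∂((gaussian (stdParam d))[|B]) ≤
      ENNReal.ofReal (probF B)⁻¹ := by
    rw [ProbabilityTheory.cond, lintegral_smul_measure, ENNReal.ofReal_inv_of_pos hB, probF,
      ofReal_measureReal (measure_ne_top _ _), smul_eq_mul]
    calc _ ≤ (gaussian (stdParam d) B)⁻¹ *
          ∫⁻ x, ENNReal.ofReal (Real.exp (-logRatio θ x)) ∂(gaussian (stdParam d)) := by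
          gcongr
          exact Measure.restrict_le_self
      _ = _ := by rw [lintegral_exp_neg_logRatio hθ, mul_one]
  have hJ := exp_integral_le_of_lintegral_le hi (inv_nonneg.2 hB.le) hle
  rwa [integral_neg, ← Real.le_log_iff_exp_le (inv_pos.2 hB), Real.log_inv] at hJ

theorem integral_inner_cond (hB : 0 < probF B) (v : E d) :
    ∫ x, ⟪v, x⟫ ∂((gaussian (stdParam d))[|B]) = ⟪v, (condParam B).1⟫ := by
  have := cond_isProbabilityMeasure (measure_ne_zero_of_probF_pos hB)
  exact integral_inner (memLp_id_cond hB) v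

theorem variance_inner_cond (hB : 0 < probF B) (v : E d) :
    Var[fun x => ⟪v, x⟫; (gaussian (stdParam d))[|B]] =
      dotProduct v.ofLp ((condParam B).2.mulVec v.ofLp) := by
  have := cond_isProbabilityMeasure (measure_ne_zero_of_probF_pos hB)
  have hco : ∀ i, MemLp (fun x : E d => x i) 2 ((gaussian (stdParam d))[|B]) := fun i => by
    simpa [EuclideanSpace.inner_single_left] using
      memLp_inner (memLp_id_cond hB) (EuclideanSpace.single i 1)
  have hfun : (fun x : E d => ⟪v, x⟫) = fun x => ∑ i, v i * x i := by
    ext x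
    simp [PiLp.inner_apply, mul_comm]
  rw [hfun, ← covariance_self ((memLp_finsetSum _ fun i _ =>
    (hco i).const_mul (v i)).aestronglyMeasurable.aemeasurable),
    covariance_fun_sum_fun_sum (fun i => (hco i).const_mul (v i))
      (fun i => (hco i).const_mul (v i))]
  simp only [dotProduct, Matrix.mulVec, Finset.mul_sum]
  refine Finset.sum_congr rfl fun i _ => Finset.sum_congr rfl fun j _ => ?_
  rw [covariance_const_mul_left, covariance_const_mul_right]
  simp only [condParam, Matrix.of_apply]
  ring

/-- Affine hyperplanes are null sets of the standard Gaussian distribution. -/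
theorem gaussian_stdParam_hyperplane {v : E d} (hv : v ≠ 0) (c : ℝ) :
    gaussian (stdParam d) {x | ⟪v, x⟫ = c} = 0 := by
  have h1 := IsGaussian.map_eq_gaussianReal (μ := stdGaussian (E d)) (innerSL ℝ v)
  rw [variance_dual_stdGaussian, innerSL_apply_norm] at h1
  have h2 : (‖v‖ ^ 2).toNNReal ≠ 0 := by
    rw [ne_eq, Real.toNNReal_eq_zero, not_le]
    have := norm_pos_iff.2 hv
    positivity
  have := nullSingletonClass_gaussianReal (μ := (stdGaussian (E d))[innerSL ℝ v]) h2
  have h3 : (stdGaussian (E d)).map (innerSL ℝ v) {c} = 0 := by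
    rw [h1]; exact measure_singleton c
  rw [Measure.map_apply (innerSL ℝ v).continuous.measurable (measurableSet_singleton c)] at h3
  rw [gaussian_stdParam]
  exact h3

theorem condParam_posDef (hB : 0 < probF B) : (condParam B).2.PosDef := by
  have := cond_isProbabilityMeasure (measure_ne_zero_of_probF_pos hB)
  refine Matrix.PosDef.of_dotProduct_mulVec_pos ?_ fun v hv => ?_
  · ext i j
    simp [condParam, covariance_comm]
  · have h1 := variance_inner_cond hB (WithLp.toLp 2 v)
    simp only [star_trivial]
    rw [← h1]
    refine lt_of_le_of_ne (variance_nonneg _ _) fun h0 => ?_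
    have h2 := ae_eq_integral_of_variance_eq_zero
      (memLp_inner (memLp_id_cond hB) (WithLp.toLp 2 v)) h0.symm
    have h3 : (gaussian (stdParam d))[|B] {x | ⟪WithLp.toLp 2 v, x⟫ =
        ∫ x, ⟪WithLp.toLp 2 v, x⟫ ∂((gaussian (stdParam d))[|B])} = 0 :=
      cond_absolutelyContinuous
        (gaussian_stdParam_hyperplane (by simpa using hv) _)
    have h4 : ∀ᵐ x ∂((gaussian (stdParam d))[|B]), False := by
      filter_upwards [h2, measure_eq_zero_iff_ae_notMem.1 h3] with x hx hx'
      exact hx' hx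
    simp [ae_iff] at h4

/-- The Gaussian density with the mean and covariance of `f` conditioned on `B` has
Kullback–Leibler divergence at most `log (1 / p_f(B))`: testing Jensen's inequality with its own
log-density, whose mean under the conditioned measure is its divergence. -/
theorem condParam_mem_klBall {δ : ℝ} (hδ : 0 < δ) (hB : δ ≤ probF B) :
    condParam B ∈ klBall d (-Real.log δ) := by
  have hB0 := hδ.trans_le hB
  have := cond_isProbabilityMeasure (measure_ne_zero_of_probF_pos hB0)
  have hS := condParam_posDef hB0
  refine ⟨hS, ?_⟩
  obtain ⟨b, lam, h⟩ := exists_diagonalizes hS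
  have h1 := integral_neg_logRatio_cond_le hS hB0
  rw [show condParam B = ((condParam B).1, (condParam B).2) from rfl,
    (h.integral_logRatio (condParam B).1 (memLp_id_cond hB0)).2] at h1
  have h2 : gaussKL (condParam B) ≤ -Real.log (probF B) := by
    refine le_trans (le_of_eq ?_) h1
    rw [show condParam B = ((condParam B).1, (condParam B).2) from rfl, h.gaussKL_eq,
      ← Finset.sum_neg_distrib]
    refine Finset.sum_congr rfl fun i _ => ?_
    have := (h.pos i).ne'
    rw [integral_inner_cond hB0, variance_inner_cond hB0, h.quadForm_basis]
    field_simp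
    ring
  exact h2.trans (neg_le_neg (Real.log_le_log hδ hB))

end Entropy

/-! ### Quantiles -/

section Quantile

theorem cdf_sInf_eq {Q : Measure ℝ} [IsProbabilityMeasure Q] (hQ : ∀ u, Q {u} = 0) {r : ℝ}
    (h0 : 0 < r) (h1 : r < 1) : cdf Q (sInf {u | r ≤ cdf Q u}) = r := by
  set s : Set ℝ := {u | r ≤ cdf Q u} with hs
  have hne : s.Nonempty := ((tendsto_order.1 (tendsto_cdf_atTop Q)).1 r h1).exists.imp
    fun u hu => hu.le
  have hbdd : BddBelow s := by
    obtain ⟨u, hu⟩ := ((tendsto_order.1 (tendsto_cdf_atBot Q)).2 r h0).exists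
    refine ⟨u, fun v hv => le_of_not_gt fun hvu => ?_⟩
    have h2 : r ≤ cdf Q v := hv
    have := monotone_cdf Q hvu.le
    linarith
  refine le_antisymm ?_ ?_
  · have h2 := (cdf Q).measure_singleton (sInf s)
    rw [measure_cdf, hQ, eq_comm, ENNReal.ofReal_eq_zero, sub_nonpos] at h2
    refine h2.trans ?_
    have h3 := (cdf Q).mono.tendsto_leftLim (sInf s)
    refine le_of_tendsto h3 ?_
    filter_upwards [self_mem_nhdsWithin] with u hu
    refine le_of_not_gt fun hru => ?_
    exact notMem_of_lt_csInf hu hbdd hru.le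
  · have h3 : Tendsto (cdf Q) (𝓝[>] (sInf s)) (𝓝 (cdf Q (sInf s))) :=
      ((cdf Q).right_continuous (sInf s)).tendsto.mono_left
        (nhdsWithin_mono _ Set.Ioi_subset_Ici_self)
    refine ge_of_tendsto h3 ?_
    filter_upwards [self_mem_nhdsWithin] with u hu
    obtain ⟨v, hv, hvu⟩ := exists_lt_of_csInf_lt hne hu
    exact le_trans hv (monotone_cdf Q hvu.le)

variable {d : ℕ}

/-- In the absence of atoms, `φ` exceeds its quantile with probability exactly `ρ`. -/
theorem measureReal_quantile_lt {φ : E d → ℝ} (hφ : Measurable φ)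
    (hatom : ∀ u : ℝ, volume (φ ⁻¹' {u}) = 0) {ρ : ℝ} (hρ : ρ ∈ Set.Ioo (0 : ℝ) 1) {θ : Param d}
    (hθ : θ.2.PosDef) : (gaussian θ).real {x | quantile φ ρ θ < φ x} = ρ := by
  have : IsProbabilityMeasure ((gaussian θ).map φ) :=
    Measure.isProbabilityMeasure_map hφ.aemeasurable
  have h := cdf_sInf_eq (Q := (gaussian θ).map φ) (fun u => by
    rw [Measure.map_apply hφ (measurableSet_singleton u)]
    exact (gaussian_absolutelyContinuous hθ).trans stdGaussian_absolutelyContinuous_volume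
      (hatom u)) (r := 1 - ρ) (by linarith [hρ.2]) (by linarith [hρ.1])
  rw [cdf_eq_real, map_measureReal_apply hφ measurableSet_Iic] at h
  have hc : {x | quantile φ ρ θ < φ x} = (φ ⁻¹' Set.Iic (quantile φ ρ θ))ᶜ := by
    ext x; simp
  rw [hc, probReal_compl_eq_one_sub (hφ measurableSet_Iic)]
  change 1 - _ = ρ
  unfold quantile
  rw [h]
  ring

theorem stdParam_mem_klBall : stdParam d ∈ klBall d 0 := by
  refine ⟨Matrix.PosDef.one, ?_⟩
  simp [gaussKL, stdParam]

/-- The deterministic cross-entropy parameters stay at bounded divergence from `N(0, I)`,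
uniformly in the dimension. -/
theorem exists_detParam_mem_klBall {ρ₀ : ℝ} (hρ₀ : 0 < ρ₀) (t : ℕ) :
    ∃ C : ℝ, ∀ (d : ℕ) (φ : E d → ℝ), Measurable φ → (∀ u : ℝ, volume (φ ⁻¹' {u}) = 0) →
      ∀ ρ ∈ Set.Ioo (0 : ℝ) 1, ρ₀ ≤ ρ → detParam φ ρ t ∈ klBall d C := by
  induction t with
  | zero => exact ⟨0, fun d φ _ _ ρ _ _ => stdParam_mem_klBall⟩
  | succ t ih =>
    obtain ⟨C, hC⟩ := ih
    refine ⟨-Real.log (Real.exp (-(C + Real.log 2) / ρ₀)), fun d φ hφ hatom ρ hρ hρ' =>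
      condParam_mem_klBall (Real.exp_pos _) ?_⟩
    have hmem := hC d φ hφ hatom ρ hρ hρ'
    exact exp_le_probF hρ₀ hmem (measurableSet_lt measurable_const hφ)
      (by rw [measureReal_quantile_lt hφ hatom hρ hmem.1]; exact hρ')

end Quantile

/-! ### Stability of the divergence bound under perturbation of the moments -/

section Perturbation

variable {d : ℕ}

theorem abs_quadForm_le {M : Matrix (Fin d) (Fin d) ℝ} {ε : ℝ} (hM : ∀ j k, |M j k| ≤ ε)
    (v : E d) : |dotProduct v.ofLp (M.mulVec v.ofLp)| ≤ d * ε * ‖v‖ ^ 2 := by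
  have h1 : |dotProduct v.ofLp (M.mulVec v.ofLp)| ≤ ∑ j, ∑ k, |v j| * (ε * |v k|) := by
    simp only [dotProduct, Matrix.mulVec]
    refine (Finset.abs_sum_le_sum_abs _ _).trans (Finset.sum_le_sum fun j _ => ?_)
    rw [abs_mul, ← Finset.mul_sum]
    gcongr
    refine (Finset.abs_sum_le_sum_abs _ _).trans (Finset.sum_le_sum fun k _ => ?_)
    rw [abs_mul]
    gcongr
    exact hM j k
  rcases Nat.eq_zero_or_pos d with rfl | hd
  · simp [dotProduct]
  have hε : 0 ≤ ε := (abs_nonneg _).trans (hM ⟨0, hd⟩ ⟨0, hd⟩)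
  have h2 : ∑ j, ∑ k, |v j| * (ε * |v k|) = ε * (∑ j, |v j|) ^ 2 := by
    rw [sq, Finset.sum_mul_sum, Finset.mul_sum]
    refine Finset.sum_congr rfl fun j _ => ?_
    rw [Finset.mul_sum]
    exact Finset.sum_congr rfl fun k _ => by ring
  have h3 := sq_sum_le_card_mul_sum_sq (s := Finset.univ) (f := fun j => |v j|)
  simp only [Finset.card_univ, Fintype.card_fin, sq_abs] at h3
  rw [← EuclideanSpace.real_norm_sq_eq] at h3
  calc _ ≤ ε * (∑ j, |v j|) ^ 2 := h1.trans h2.le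
    _ ≤ ε * (d * ‖v‖ ^ 2) := by gcongr
    _ = _ := by ring

theorem norm_le_of_abs_le {v : E d} {ε : ℝ} (hε : 0 ≤ ε) (hv : ∀ j, |v j| ≤ ε) :
    ‖v‖ ≤ d * ε := by
  refine abs_le_of_sq_le_sq' ?_ (by positivity) |>.2
  rw [EuclideanSpace.real_norm_sq_eq]
  calc ∑ j, v j ^ 2 ≤ ∑ _j : Fin d, ε ^ 2 := Finset.sum_le_sum fun j _ =>
        sq_le_sq.2 ((hv j).trans (le_abs_self ε))
    _ = d * ε ^ 2 := by simp
    _ ≤ (d * ε) ^ 2 := by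
        rcases Nat.eq_zero_or_pos d with h | h
        · simp [h]
        · have : (1 : ℝ) ≤ d := by exact_mod_cast h
          have h2 := sq_nonneg ε
          rw [mul_pow]
          gcongr
          nlinarith

theorem eigBound_mul_le_quadForm {C : ℝ} {θ : Param d} (hθ : θ ∈ klBall d C) (v : E d) :
    eigBound C * ‖v‖ ^ 2 ≤ dotProduct v.ofLp (θ.2.mulVec v.ofLp) := by
  obtain ⟨b, lam, h⟩ := exists_diagonalizes hθ.1
  rw [h.quadForm, ← b.sum_sq_inner_right v, Finset.mul_sum]
  exact Finset.sum_le_sum fun i _ =>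
    mul_le_mul_of_nonneg_right (h.eigBound_le (μ := θ.1) hθ.2 i) (sq_nonneg _)

theorem norm_mean_sq_le {C : ℝ} {θ : Param d} (hθ : θ ∈ klBall d C) : ‖θ.1‖ ^ 2 ≤ 2 * C := by
  obtain ⟨b, lam, h⟩ := exists_diagonalizes hθ.1
  have h1 : gaussKL (θ.1, θ.2) ≤ C := hθ.2
  rw [h.gaussKL_eq] at h1
  rw [← b.sum_sq_inner_right θ.1]
  calc ∑ i, ⟪b i, θ.1⟫ ^ 2 ≤
        2 * ∑ i, (⟪b i, θ.1⟫ ^ 2 + (lam i - 1 - Real.log (lam i))) / 2 := by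
        rw [Finset.mul_sum]
        refine Finset.sum_le_sum fun i _ => ?_
        have := Real.log_le_sub_one_of_pos (h.pos i)
        linarith
    _ ≤ _ := by linarith

/-- The constant in `mem_klBall_of_near`: a perturbation of size `τ` of the mean and covariance
raises the contribution of each eigendirection to the divergence by at most
`τ * stabConst C / 2`. -/
noncomputable def stabConst (C : ℝ) : ℝ := 3 + 2 * C + 4 / eigBound C

theorem stabConst_ge {C : ℝ} (hC : 0 ≤ C) : 7 ≤ stabConst C := by
  have h1 := eigBound_le_one hC
  have h2 := eigBound_pos C
  have : 4 ≤ 4 / eigBound C := by rw [le_div_iff₀ h2]; linarith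
  unfold stabConst
  linarith

/-- Parameters close to the mean and covariance of `f` conditioned on `B` have bounded
Kullback–Leibler divergence. Jensen's inequality is applied to the log-density with the perturbed
parameters, in an eigenbasis of the perturbed covariance matrix. -/
theorem mem_klBall_of_near (hd : 0 < d) {δ : ℝ} (hδ : 0 < δ) {B : Set (E d)} (hB : δ ≤ probF B)
    {θ : Param d} (hsymm : θ.2.IsHermitian) {τ : ℝ}
    (hmean : ‖θ.1 - (condParam B).1‖ ≤ τ)
    (hcov : ∀ v : E d, |dotProduct v.ofLp ((θ.2 - (condParam B).2).mulVec v.ofLp)| ≤ τ * ‖v‖ ^ 2)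
    (hτ : d * τ * stabConst (-Real.log δ) ≤ 2) : θ ∈ klBall d (-Real.log δ + 1) := by
  set C : ℝ := -Real.log δ with hCdef
  have hB0 := hδ.trans_le hB
  have hball : condParam B ∈ klBall d C := condParam_mem_klBall hδ hB
  have hC : 0 ≤ C := (gaussKL_nonneg hball.1).trans hball.2
  have hK := stabConst_ge hC
  have hc := eigBound_pos C
  have hc1 := eigBound_le_one hC
  have hd1 : (1 : ℝ) ≤ d := by exact_mod_cast hd
  have hτ0 : 0 ≤ τ := (norm_nonneg _).trans hmean
  have hτK : τ * stabConst C ≤ 2 := by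
    refine le_trans ?_ hτ
    gcongr
    nlinarith
  have hτ1 : τ ≤ 1 := by nlinarith
  have hτc : τ ≤ eigBound C / 2 := by
    have h1 : τ * (4 / eigBound C) ≤ 2 := by
      refine le_trans ?_ hτK
      gcongr
      unfold stabConst
      linarith
    rw [mul_div_assoc', div_le_iff₀ hc] at h1
    linarith
  have hlow : ∀ v : E d, eigBound C / 2 * ‖v‖ ^ 2 ≤ dotProduct v.ofLp (θ.2.mulVec v.ofLp) := by
    intro v
    have h1 := eigBound_mul_le_quadForm hball v
    have h2 := (abs_le.1 (hcov v)).1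
    rw [Matrix.sub_mulVec, dotProduct_sub] at h2
    nlinarith [sq_nonneg ‖v‖]
  have hpos : θ.2.PosDef := by
    refine Matrix.PosDef.of_dotProduct_mulVec_pos hsymm fun v hv => ?_
    have h1 := hlow (WithLp.toLp 2 v)
    have h2 : 0 < ‖(WithLp.toLp 2 v : E d)‖ := norm_pos_iff.2 (by simpa using hv)
    simp only [star_trivial]
    exact lt_of_lt_of_le (by positivity) h1
  refine ⟨hpos, ?_⟩
  obtain ⟨b, lam, h⟩ := exists_diagonalizes hpos
  have := cond_isProbabilityMeasure (measure_ne_zero_of_probF_pos hB0)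
  have hJ := integral_neg_logRatio_cond_le hpos hB0
  rw [show θ = (θ.1, θ.2) from rfl, (h.integral_logRatio θ.1 (memLp_id_cond hB0)).2] at hJ
  have hJ' := hJ.trans (neg_le_neg (Real.log_le_log hδ hB))
  simp only [integral_inner_cond hB0, variance_inner_cond hB0] at hJ'
  rw [← hCdef, ← Finset.sum_neg_distrib] at hJ'
  have hterm : ∀ i, (⟪b i, θ.1⟫ ^ 2 + (lam i - 1 - Real.log (lam i))) / 2 ≤
      -((Real.log (lam i) - (dotProduct (b i).ofLp ((condParam B).2.mulVec (b i).ofLp) +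
        ⟪b i, (condParam B).1⟫ ^ 2) +
        (dotProduct (b i).ofLp ((condParam B).2.mulVec (b i).ofLp) +
          (⟪b i, (condParam B).1⟫ - ⟪b i, θ.1⟫) ^ 2) / lam i) / 2) +
        τ * stabConst C / 2 := by
    intro i
    set s : ℝ := dotProduct (b i).ofLp ((condParam B).2.mulVec (b i).ofLp) with hs
    set p : ℝ := ⟪b i, (condParam B).1⟫ with hp
    set p' : ℝ := ⟪b i, θ.1⟫ with hp'
    have hl := hlow (b i)
    have hcv := hcov (b i)
    rw [Matrix.sub_mulVec, dotProduct_sub] at hcv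
    rw [h.quadForm_basis] at hl hcv
    simp only [b.norm_eq_one, one_pow, mul_one] at hl hcv
    rw [← hs] at hcv
    have hpp : |p' - p| ≤ τ := by
      rw [hp, hp', ← inner_sub_right]
      refine (abs_real_inner_le_norm _ _).trans ?_
      rw [b.norm_eq_one, one_mul]
      exact hmean
    have hp2 : p ^ 2 ≤ 2 * C := by
      refine le_trans ?_ (norm_mean_sq_le hball)
      rw [hp, ← sq_abs]
      have := abs_real_inner_le_norm (b i) (condParam B).1
      rw [b.norm_eq_one, one_mul] at this
      gcongr
    have hli : (lam i)⁻¹ ≤ 2 / eigBound C := by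
      rw [inv_le_comm₀ (h.pos i) (by positivity), inv_div]
      exact hl
    have hli0 : 0 < (lam i)⁻¹ := inv_pos.2 (h.pos i)
    obtain ⟨ha1, ha2⟩ := abs_le.1 hcv
    obtain ⟨hb1, hb2⟩ := abs_le.1 hpp
    have e1 : (s - lam i) * (lam i)⁻¹ ≤ τ * (2 / eigBound C) :=
      mul_le_mul (by linarith) hli hli0.le hτ0
    have e2 : (p - p') ^ 2 * (lam i)⁻¹ ≤ τ * (2 / eigBound C) := by
      refine mul_le_mul ?_ hli hli0.le hτ0
      nlinarith
    have e3 : p' ^ 2 - p ^ 2 ≤ τ * (2 + 2 * C) := by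
      have : p' ^ 2 - p ^ 2 = (p' - p) * (p' - p) + 2 * p * (p' - p) := by ring
      have h1 : (p' - p) * (p' - p) ≤ τ := by nlinarith
      have h2 : 2 * p * (p' - p) ≤ τ * (1 + 2 * C) := by
        calc 2 * p * (p' - p) ≤ |2 * p * (p' - p)| := le_abs_self _
          _ = |2 * p| * |p' - p| := abs_mul _ _
          _ ≤ (1 + 2 * C) * τ := by
              gcongr
              rw [abs_le]
              constructor <;> nlinarith [sq_nonneg (p - 1), sq_nonneg (p + 1)]
          _ = _ := by ring
      linarith
    have e4 : (s + (p - p') ^ 2) / lam i =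
        (s - lam i) * (lam i)⁻¹ + 1 + (p - p') ^ 2 * (lam i)⁻¹ := by
      have := (h.pos i).ne'
      field_simp
      ring
    have e5 : τ * stabConst C = τ * (2 + 2 * C) + τ + τ * (2 / eigBound C) +
        τ * (2 / eigBound C) := by
      unfold stabConst
      ring
    rw [e4, e5]
    linarith
  rw [show θ = (θ.1, θ.2) from rfl, h.gaussKL_eq]
  refine (Finset.sum_le_sum fun i _ => hterm i).trans ?_
  rw [Finset.sum_add_distrib]
  have hsum : ∑ _i : Fin d, τ * stabConst C / 2 = d * τ * stabConst C / 2 := by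
    simp; ring
  rw [hsum]
  linarith

end Perturbation

/-! ### The empirical quantile -/

section EmpiricalQuantile

variable {d m : ℕ}

theorem le_mean_indicator_of_lt_orderStat {ρ : ℝ} (hm : 0 < m)
    (v : Fin m → ℝ) {u : ℝ} (h : (u : EReal) < orderStat v ⌊(1 - ρ) * m⌋₊) :
    ρ ≤ 1 / (m : ℝ) * ∑ i, (Set.Ioi u).indicator (fun _ => (1 : ℝ)) (v i) := by
  have hm' : (0 : ℝ) < m := by exact_mod_cast hm
  unfold orderStat at h
  split_ifs at h with hk
  swap
  · simp at h
  have hlt : u < v (Tuple.sort v ⟨⌊(1 - ρ) * m⌋₊ - 1, by omega⟩) := by exact_mod_cast h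
  have h1 := Tuple.lt_card_le_iff_apply_le_of_monotone (f := v ∘ Tuple.sort v)
    (a := u) (j := ⟨⌊(1 - ρ) * m⌋₊ - 1, by omega⟩) (Tuple.monotone_sort v)
  have h2 : ∑ i, (if v i ≤ u then 1 else 0) = ∑ i, (if v (Tuple.sort v i) ≤ u then 1 else 0) :=
    (Equiv.sum_comp (Tuple.sort v) fun i => if v i ≤ u then 1 else 0).symm
  have h3 : ∑ i, (if v i ≤ u then 1 else 0) ≤ ⌊(1 - ρ) * m⌋₊ - 1 := by
    rw [h2, ← Finset.card_filter]
    by_contra hcon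
    exact absurd (h1.1 (not_le.1 hcon)) (not_le.2 hlt)
  have h4 : ((∑ i, (if v i ≤ u then 1 else 0) : ℕ) : ℝ) ≤ (1 - ρ) * m := by
    have h5 : (∑ i, (if v i ≤ u then 1 else 0) : ℕ) ≤ ⌊(1 - ρ) * m⌋₊ := h3.trans (Nat.sub_le _ _)
    have h6 : (0 : ℝ) ≤ (1 - ρ) * m := by
      by_contra hneg
      rw [Nat.floor_of_nonpos (not_le.1 hneg).le] at hk
      omega
    exact (Nat.le_floor_iff h6).1 h5
  have h7 : ∑ i, (Set.Ioi u).indicator (fun _ => (1 : ℝ)) (v i) =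
      m - ((∑ i, (if v i ≤ u then 1 else 0) : ℕ) : ℝ) := by
    have : ∀ i, (Set.Ioi u).indicator (fun _ => (1 : ℝ)) (v i) =
        1 - ((if v i ≤ u then 1 else 0 : ℕ) : ℝ) := by
      intro i
      by_cases hi : v i ≤ u
      · simp [hi]
      · simp [hi, not_le.1 hi]
    simp only [this, Finset.sum_sub_distrib]
    simp
  rw [h7, one_div, le_inv_mul_iff₀ hm']
  linarith

/-- The empirical quantile exceeds the `(1 - ρ / 2)`-quantile with small probability, so that the
set selected by the empirical quantile has `g`-probability at least `ρ / 2`. -/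
theorem measure_empQuantile_bad_le {φ : E d → ℝ} (hφ : Measurable φ)
    (hatom : ∀ u : ℝ, volume (φ ⁻¹' {u}) = 0) {ρ : ℝ} (hρ : ρ ∈ Set.Ioo (0 : ℝ) 1) {θ : Param d}
    (hθ : θ.2.PosDef) (hm : 0 < m) :
    iidGaussian m θ {y' | ¬ ρ / 2 ≤ (gaussian θ).real {x | empQuantile φ ρ y' < (φ x : EReal)}} ≤
      ENNReal.ofReal (2 / ρ * Real.sqrt (1 / m)) := by
  set u : ℝ := quantile φ (ρ / 2) θ with hu
  set U : Set (E d) := {x | u < φ x} with hUdef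
  have hU : MeasurableSet U := measurableSet_lt measurable_const hφ
  have hUρ : (gaussian θ).real U = ρ / 2 :=
    measureReal_quantile_lt hφ hatom ⟨by linarith [hρ.1], by linarith [hρ.2, hρ.1]⟩ hθ
  set Z : E d → ℝ := U.indicator fun _ => (1 : ℝ) with hZdef
  have hZ : MemLp Z 2 (gaussian θ) := (memLp_const 1).indicator hU
  have hZmean : ∫ x, Z x ∂(gaussian θ) = ρ / 2 := by
    rw [hZdef, integral_indicator_const _ hU, hUρ]; simp
  have hZsq : ∫ x, Z x ^ 2 ∂(gaussian θ) ≤ 1 := by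
    have : ∀ x, Z x ^ 2 = Z x := by
      intro x; by_cases hx : x ∈ U <;> simp [hZdef, hx]
    simp only [this, hZmean]
    linarith [hρ.2]
  have hL := integral_abs_mean_sub_le hm hZ
  rw [hZmean] at hL
  have hint : Integrable (fun y : Fin m → E d => |1 / (m : ℝ) * ∑ i, Z (y i) - ρ / 2|)
      (iidGaussian m θ) :=
    (((integrable_finsetSum _ fun i _ => integrable_comp_eval
      (hZ.integrable (by norm_num)) i).const_mul _).sub (integrable_const _)).abs
  have hM := mul_meas_ge_le_integral_of_nonneg (ae_of_all _ fun _ => abs_nonneg _) hint (ρ / 2)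
  have hsub : {y' : Fin m → E d |
      ¬ ρ / 2 ≤ (gaussian θ).real {x | empQuantile φ ρ y' < (φ x : EReal)}} ⊆
      {y | ρ / 2 ≤ |1 / (m : ℝ) * ∑ i, Z (y i) - ρ / 2|} := by
    intro y hy
    simp only [Set.mem_ofPred_eq] at hy ⊢
    have hlt : (u : EReal) < empQuantile φ ρ y := by
      by_contra hle
      refine hy ?_
      rw [← hUρ]
      refine measureReal_mono fun x hx => ?_
      exact (not_lt.1 hle).trans_lt (EReal.coe_lt_coe_iff.2 hx)
    have h1 := le_mean_indicator_of_lt_orderStat hm (fun i => φ (y i)) hlt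
    have h2 : ∀ i, Z (y i) = (Set.Ioi u).indicator (fun _ => (1 : ℝ)) (φ (y i)) := fun i => rfl
    simp only [h2]
    exact le_trans (by linarith) (le_abs_self _)
  refine (measure_mono hsub).trans ?_
  rw [← ofReal_measureReal (measure_ne_top _ _)]
  apply ENNReal.ofReal_le_ofReal
  have h1 : Real.sqrt ((∫ x, Z x ^ 2 ∂(gaussian θ)) / m) ≤ Real.sqrt (1 / m) := by
    apply Real.sqrt_le_sqrt
    gcongr
  have h2 := hM.trans (hL.trans h1)
  rw [div_mul_eq_mul_div, le_div_iff₀ hρ.1]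
  linarith

end EmpiricalQuantile

/-! ### Empirical moments -/

section EmpiricalMoments

variable {d n : ℕ}

/-- The coordinates of `x`, together with the constant `1`: products of two of these functions are
the integrands of the probability, mean and second moment estimators. -/
def extCoord (a : Option (Fin d)) (x : E d) : ℝ := a.elim 1 fun j => x j

theorem measurable_extCoord (a : Option (Fin d)) : Measurable (extCoord a) := by
  cases a with
  | none => exact measurable_const
  | some j => exact (measurable_pi_apply j).comp (WithLp.measurable_ofLp 2 _)

/-- A bound for the `L²` norms under `f` of the products of two extended coordinates. -/
noncomputable def momentBound : ℝ := Real.sqrt (1 + ∫ z, z ^ 4 ∂(gaussianReal 0 1))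

theorem one_le_momentBound : 1 ≤ momentBound := by
  have : 0 ≤ ∫ z : ℝ, z ^ 4 ∂(gaussianReal 0 1) := integral_nonneg fun z => by positivity
  rw [momentBound, Real.one_le_sqrt]
  linarith

theorem integrable_pow_four_gaussianReal :
    Integrable (fun z : ℝ => z ^ 4) (gaussianReal 0 1) := by
  have h := (memLp_id_gaussianReal (μ := 0) (v := 1) 4).integrable_norm_pow (by norm_num)
  refine h.congr (ae_of_all _ fun z => ?_)
  simp only [id, Real.norm_eq_abs]
  norm_num [Even.pow_abs (by decide : Even 4)]

theorem integral_extCoord_pow_four (a : Option (Fin d)) :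
    Integrable (fun x => extCoord a x ^ 4) (gaussian (stdParam d)) ∧
      ∫ x, extCoord a x ^ 4 ∂(gaussian (stdParam d)) ≤ momentBound ^ 2 := by
  have h0 : 0 ≤ ∫ z : ℝ, z ^ 4 ∂(gaussianReal 0 1) := integral_nonneg fun z => by positivity
  rw [momentBound, Real.sq_sqrt (by linarith)]
  cases a with
  | none => simp [extCoord, h0]
  | some j =>
    have h := measurePreserving_eval_multivariateGaussian (μ := (0 : E d))
      (S := (1 : Matrix (Fin d) (Fin d) ℝ)) Matrix.PosSemidef.one (i := j)
    simp only [PiLp.zero_apply, Matrix.one_apply_eq, Real.toNNReal_one] at h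
    have hi := integrable_pow_four_gaussianReal
    rw [← h.map_eq] at hi h0 ⊢
    rw [integral_map h.measurable.aemeasurable hi.aestronglyMeasurable]
    refine ⟨hi.comp_measurable h.measurable, ?_⟩
    change ∫ x : E d, x j ^ 4 ∂(multivariateGaussian 0 1) ≤ _
    linarith

variable {B : Set (E d)}

/-- The integrand `1_B(x) x_a x_b` of the empirical moments. -/
noncomputable def momentFun (B : Set (E d)) (a b : Option (Fin d)) : E d → ℝ :=
  B.indicator fun x => extCoord a x * extCoord b x

theorem measurable_momentFun (hB : MeasurableSet B) (a b : Option (Fin d)) :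
    Measurable (momentFun B a b) :=
  ((measurable_extCoord a).mul (measurable_extCoord b)).indicator hB

theorem momentFun_sq_le (a b : Option (Fin d)) (x : E d) :
    momentFun B a b x ^ 2 ≤ (extCoord a x ^ 4 + extCoord b x ^ 4) / 2 := by
  by_cases hx : x ∈ B
  · simp only [momentFun, Set.indicator_of_mem hx]
    nlinarith [sq_nonneg (extCoord a x ^ 2 - extCoord b x ^ 2)]
  · rw [momentFun, Set.indicator_of_notMem hx, zero_pow two_ne_zero]
    positivity

theorem memLp_momentFun (hB : MeasurableSet B) (a b : Option (Fin d)) :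
    MemLp (momentFun B a b) 2 (gaussian (stdParam d)) ∧
      ∫ x, momentFun B a b x ^ 2 ∂(gaussian (stdParam d)) ≤ momentBound ^ 2 := by
  have ha := integral_extCoord_pow_four a
  have hb := integral_extCoord_pow_four b
  have hdom := (ha.1.add hb.1).div_const 2
  have hm := (measurable_momentFun hB a b)
  have h2 : MemLp (momentFun B a b) 2 (gaussian (stdParam d)) := by
    rw [memLp_two_iff_integrable_sq hm.aestronglyMeasurable]
    refine hdom.mono' (hm.pow_const 2).aestronglyMeasurable (ae_of_all _ fun x => ?_)
    rw [Real.norm_of_nonneg (sq_nonneg _)]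
    exact momentFun_sq_le a b x
  refine ⟨h2, (integral_mono h2.integrable_sq hdom (momentFun_sq_le a b)).trans ?_⟩
  simp only [Pi.add_apply]
  rw [integral_div, integral_add ha.1 hb.1]
  linarith [ha.2, hb.2]

/-- The moments `E_f (1_B(X) X_a X_b)`. -/
noncomputable def moment (B : Set (E d)) (a b : Option (Fin d)) : ℝ :=
  ∫ x, momentFun B a b x ∂(gaussian (stdParam d))

theorem abs_moment_le (hB : MeasurableSet B) (a b : Option (Fin d)) :
    |moment B a b| ≤ momentBound := by
  obtain ⟨h1, h2⟩ := memLp_momentFun hB a b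
  refine abs_integral_le_integral_abs.trans ((integral_abs_le_sqrt h1).trans ?_)
  exact (Real.sqrt_le_sqrt h2).trans (Real.sqrt_sq (by linarith [one_le_momentBound])).le

/-- The importance sampling estimator of `moment B a b`. -/
noncomputable def empMoment (θ : Param d) (B : Set (E d)) (y : Fin n → E d)
    (a b : Option (Fin d)) : ℝ :=
  1 / (n : ℝ) * ∑ i, Real.exp (logRatio θ (y i)) * momentFun B a b (y i)

theorem measure_empMoment_bad_le {C : ℝ} {θ : Param d} (hθ : θ ∈ klBall d C) (hn : 0 < n)
    (hB : MeasurableSet B) {η : ℝ} (hη : 0 < η) :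
    iidGaussian n θ {y | ∃ a b, η ≤ |empMoment θ B y a b - moment B a b|} ≤
      ENNReal.ofReal ((d + 1) ^ 2 *
        (momentBound * ((2 * Real.exp C + 1) * (n : ℝ) ^ (-rateExp C)) / η)) := by
  have hV := one_le_momentBound
  have hab : ∀ a b, iidGaussian n θ {y | η ≤ |empMoment θ B y a b - moment B a b|} ≤
      ENNReal.ofReal (momentBound * ((2 * Real.exp C + 1) * (n : ℝ) ^ (-rateExp C)) / η) := by
    intro a b
    obtain ⟨h1, h2⟩ := memLp_momentFun hB a b
    have h3 := integral_abs_weighted_mean_sub_le_rate hθ hn (measurable_momentFun hB a b) h1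
      (by linarith) h2
    have hM : Measurable fun y : Fin n → E d => ENNReal.ofReal
        |empMoment θ B y a b - moment B a b| := by
      have : Measurable fun y : Fin n → E d => empMoment θ B y a b :=
        (Finset.measurable_sum _ fun i _ => ((measurable_exp_logRatio θ).mul
          (measurable_momentFun hB a b)).comp (measurable_pi_apply i)).const_mul _
      exact (continuous_abs.measurable.comp (this.sub_const _)).ennreal_ofReal
    have h4 := meas_ge_le_lintegral_div (μ := iidGaussian n θ) hM.aemeasurable
      (ENNReal.ofReal_pos.2 hη).ne' ENNReal.ofReal_ne_top
    have h5 : {y : Fin n → E d | η ≤ |empMoment θ B y a b - moment B a b|} ⊆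
        {y | ENNReal.ofReal η ≤ ENNReal.ofReal |empMoment θ B y a b - moment B a b|} :=
      fun y hy => ENNReal.ofReal_le_ofReal hy
    refine (measure_mono h5).trans (h4.trans ?_)
    rw [ENNReal.ofReal_div_of_pos hη]
    gcongr
    exact h3
  have hsub : {y : Fin n → E d | ∃ a b, η ≤ |empMoment θ B y a b - moment B a b|} =
      ⋃ p : Option (Fin d) × Option (Fin d),
        {y | η ≤ |empMoment θ B y p.1 p.2 - moment B p.1 p.2|} := by
    ext y; simp
  rw [hsub]
  refine (measure_iUnion_fintype_le _ _).trans ((Finset.sum_le_sum fun p _ => hab p.1 p.2).trans ?_)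
  simp only [Finset.sum_const, Finset.card_univ, Fintype.card_prod, Fintype.card_option,
    Fintype.card_fin]
  rw [← ENNReal.ofReal_nsmul]
  apply ENNReal.ofReal_le_ofReal
  rw [nsmul_eq_mul]
  push_cast
  rw [sq]

theorem moment_none_none (hB : MeasurableSet B) : moment B none none = probF B := by
  simp only [moment, momentFun, extCoord, Option.elim, mul_one]
  rw [integral_indicator_const _ hB]
  simp [probF]

theorem integral_cond_eq (hB : MeasurableSet B) (F : E d → ℝ) :
    ∫ x, F x ∂((gaussian (stdParam d))[|B]) =
      (∫ x, B.indicator F x ∂(gaussian (stdParam d))) / probF B := by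
  rw [ProbabilityTheory.cond, integral_smul_measure, integral_indicator hB, ENNReal.toReal_inv,
    smul_eq_mul, probF, measureReal_def, div_eq_inv_mul]

theorem condParam_mean_apply (hB : MeasurableSet B) (hB0 : 0 < probF B) (j : Fin d) :
    (condParam B).1 j = moment B (some j) none / probF B := by
  have h1 := integral_inner_cond hB0 (EuclideanSpace.single j 1)
  simp only [EuclideanSpace.inner_single_left, map_one, one_mul] at h1
  rw [← h1, integral_cond_eq hB]
  simp [moment, momentFun, extCoord]

theorem condParam_cov_apply (hB : MeasurableSet B) (hB0 : 0 < probF B) (j k : Fin d) :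
    (condParam B).2 j k = moment B (some j) (some k) / probF B -
      (condParam B).1 j * (condParam B).1 k := by
  have := cond_isProbabilityMeasure (measure_ne_zero_of_probF_pos hB0)
  have hco : ∀ i, MemLp (fun x : E d => x i) 2 ((gaussian (stdParam d))[|B]) := fun i => by
    simpa [EuclideanSpace.inner_single_left] using
      memLp_inner (memLp_id_cond hB0) (EuclideanSpace.single i 1)
  have hmean : ∀ i, ∫ x, x i ∂((gaussian (stdParam d))[|B]) = (condParam B).1 i := fun i => by
    simpa [EuclideanSpace.inner_single_left] using
      integral_inner_cond hB0 (EuclideanSpace.single i 1)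
  have h1 : (condParam B).2 j k = cov[fun x => x j, fun x => x k; (gaussian (stdParam d))[|B]] :=
    rfl
  rw [h1, covariance_eq_sub (hco j) (hco k), hmean, hmean]
  simp only [Pi.mul_apply]
  rw [integral_cond_eq hB]
  rfl

theorem ceWeight_eq {m : ℕ} {φ : E d → ℝ} {ρ : ℝ} {θ : Param d} (hθ : θ.2.PosDef)
    (y' : Fin m → E d) (x : E d) : ceWeight φ ρ θ y' x = Real.exp (logRatio θ x) *
      {x : E d | empQuantile φ ρ y' < (φ x : EReal)}.indicator (fun _ => 1) x := by
  unfold ceWeight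
  rw [likelihoodRatio_eq hθ]
  by_cases hx : x ∈ {x : E d | empQuantile φ ρ y' < (φ x : EReal)}
  · simp only [Set.indicator_of_mem hx, mul_one]
  · simp only [Set.indicator_of_notMem hx, mul_zero]

section Ratios

variable {m : ℕ} {φ : E d → ℝ} {ρ : ℝ} {θ : Param d} (y' : Fin m → E d) (y : Fin n → E d)

theorem ceProb_eq (hθ : θ.2.PosDef) : ceProb φ ρ θ y' y =
    empMoment θ {x : E d | empQuantile φ ρ y' < (φ x : EReal)} y none none := by
  simp only [ceProb, empMoment, ceWeight_eq hθ, momentFun, extCoord, Option.elim, mul_one]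

theorem ceMean_apply (hθ : θ.2.PosDef) (j : Fin d) : ceMean φ ρ θ y' y j =
    empMoment θ {x : E d | empQuantile φ ρ y' < (φ x : EReal)} y (some j) none /
      ceProb φ ρ θ y' y := by
  have h : ∀ i, ceWeight φ ρ θ y' (y i) * y i j = Real.exp (logRatio θ (y i)) *
      momentFun {x : E d | empQuantile φ ρ y' < (φ x : EReal)} (some j) none (y i) := by
    intro i
    rw [ceWeight_eq hθ, momentFun, mul_assoc]
    by_cases hx : y i ∈ {x : E d | empQuantile φ ρ y' < (φ x : EReal)}
    · simp only [Set.indicator_of_mem hx]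
      simp [extCoord]
    · simp only [Set.indicator_of_notMem hx, zero_mul]
  simp only [ceMean, empMoment, ← h]
  simp
  ring

theorem ceCov_apply (hθ : θ.2.PosDef) (j k : Fin d) : ceCov φ ρ θ y' y j k =
    empMoment θ {x : E d | empQuantile φ ρ y' < (φ x : EReal)} y (some j) (some k) /
      ceProb φ ρ θ y' y - ceMean φ ρ θ y' y j * ceMean φ ρ θ y' y k := by
  have h : ∀ i, ceWeight φ ρ θ y' (y i) * (y i j * y i k) = Real.exp (logRatio θ (y i)) *
      momentFun {x : E d | empQuantile φ ρ y' < (φ x : EReal)} (some j) (some k) (y i) := by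
    intro i
    rw [ceWeight_eq hθ, momentFun, mul_assoc]
    by_cases hx : y i ∈ {x : E d | empQuantile φ ρ y' < (φ x : EReal)}
    · simp only [Set.indicator_of_mem hx]
      simp [extCoord]
    · simp only [Set.indicator_of_notMem hx, zero_mul]
  simp only [ceCov, empMoment, ← h]
  simp [Matrix.vecMulVec_apply, Matrix.sum_apply]
  ring

end Ratios

end EmpiricalMoments

/-! ### One iteration of the stochastic scheme -/

section OneStep

variable {d m n : ℕ}

theorem abs_div_sub_div_le {T M s p η V δ : ℝ} (hT : |T - M| ≤ η) (hs : |s - p| ≤ η)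
    (hM : |M| ≤ V) (hV : 1 ≤ V) (hδ : 0 < δ) (hp : δ ≤ p) (hp1 : p ≤ 1) (hη : η ≤ δ / 2) :
    |T / s - M / p| ≤ 4 * V * η / δ ^ 2 := by
  have hη0 : 0 ≤ η := (abs_nonneg _).trans hT
  have hp0 : 0 < p := hδ.trans_le hp
  have hs0 : δ / 2 ≤ s := by linarith [(abs_le.1 hs).1]
  have hs1 : 0 < s := by linarith
  have h1 : T / s - M / p = ((T - M) * p - M * (s - p)) / (s * p) := by
    field_simp
    ring
  have h2 : |(T - M) * p - M * (s - p)| ≤ 2 * V * η := by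
    calc _ ≤ |(T - M) * p| + |M * (s - p)| := abs_sub _ _
      _ = |T - M| * p + |M| * |s - p| := by rw [abs_mul, abs_mul, abs_of_pos hp0]
      _ ≤ η * 1 + V * η := by gcongr
      _ ≤ _ := by nlinarith
  have h3 : δ ^ 2 / 2 ≤ s * p := by nlinarith
  rw [h1, abs_div, abs_of_pos (mul_pos hs1 hp0)]
  calc _ ≤ 2 * V * η / (δ ^ 2 / 2) := by gcongr
    _ = _ := by field_simp; ring

/-- The precision required of the empirical moments, up to a factor `d ^ 2`. Precision `η` of the
moments gives precision `ε = 16 V² η / δ³` of the mean and of the entries of the covariance matrix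
(`V` being `momentBound`), hence `τ = d ε` in `mem_klBall_of_near`; the value is the solution of
`d τ K = 2`, with `K` the constant `stabConst`. -/
noncomputable def precision (δ : ℝ) : ℝ :=
  δ ^ 3 / (8 * momentBound ^ 2 * stabConst (-Real.log δ))

theorem precision_pos {δ : ℝ} (hδ : 0 < δ) (hδ1 : δ ≤ 1) : 0 < precision δ := by
  have h1 := stabConst_ge (C := -Real.log δ) (by linarith [Real.log_nonpos hδ.le hδ1])
  have h2 := one_le_momentBound
  unfold precision
  positivity

/-- If all the empirical moments are precise, the next parameters have bounded divergence. -/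
theorem ce_mem_klBall_of_near (hd : 0 < d) {φ : E d → ℝ} (hφ : Measurable φ) {ρ : ℝ}
    {θ : Param d} (hθ : θ.2.PosDef) {δ : ℝ} (hδ : 0 < δ) (y' : Fin m → E d) (y : Fin n → E d)
    (hB : δ ≤ probF {x : E d | empQuantile φ ρ y' < (φ x : EReal)})
    (hy : ∀ a b, |empMoment θ {x : E d | empQuantile φ ρ y' < (φ x : EReal)} y a b -
      moment {x : E d | empQuantile φ ρ y' < (φ x : EReal)} a b| ≤ precision δ / d ^ 2) :
    (ceMean φ ρ θ y' y, ceCov φ ρ θ y' y) ∈ klBall d (-Real.log δ + 1) := by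
  set B : Set (E d) := {x : E d | empQuantile φ ρ y' < (φ x : EReal)} with hBdef
  have hBm : MeasurableSet B := measurableSet_lt measurable_const hφ.coe_real_ereal
  set V := momentBound with hVdef
  have hV : 1 ≤ V := one_le_momentBound
  set η : ℝ := precision δ / d ^ 2 with hη
  have hB0 := hδ.trans_le hB
  have hp1 : probF B ≤ 1 := measureReal_le_one
  have hδ1 : δ ≤ 1 := hB.trans hp1
  have hK := stabConst_ge (C := -Real.log δ) (by linarith [Real.log_nonpos hδ.le hδ1])
  set K := stabConst (-Real.log δ) with hKdef
  have hd1 : (1 : ℝ) ≤ d := by exact_mod_cast hd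
  have hh0 : 0 < precision δ := precision_pos hδ hδ1
  have hη0 : 0 ≤ η := by positivity
  have hηh : η ≤ precision δ := div_le_self hh0.le (one_le_pow₀ hd1)
  have hV2 : 1 ≤ V ^ 2 := one_le_pow₀ hV
  have hVK : 7 ≤ V ^ 2 * K := by nlinarith
  have hhδ : precision δ * (8 * (V ^ 2 * K)) = δ ^ 3 := by
    unfold precision
    rw [← hVdef, ← hKdef]
    field_simp
  have hδ3 : δ ^ 3 ≤ δ := by nlinarith [sq_nonneg δ, mul_nonneg hδ.le hδ.le]
  have hηδ : η ≤ δ / 2 := by nlinarith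
  set ε₁ : ℝ := 4 * V * η / δ ^ 2 with hε₁
  have hε₁0 : 0 ≤ ε₁ := by positivity
  have hε₁1 : ε₁ ≤ 1 := by
    rw [hε₁, div_le_one (by positivity)]
    have h1 : 8 * V ≤ 8 * (V ^ 2 * K) := by nlinarith
    have h2 : precision δ * (8 * V) ≤ δ ^ 3 := by rw [← hhδ]; gcongr
    have h3 : δ ^ 3 ≤ δ ^ 2 := by nlinarith [sq_nonneg δ]
    nlinarith
  have hs : |ceProb φ ρ θ y' y - probF B| ≤ η := by
    rw [ceProb_eq y' y hθ, ← moment_none_none hBm]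
    exact hy none none
  have hratio : ∀ a b, |empMoment θ B y a b / ceProb φ ρ θ y' y - moment B a b / probF B| ≤ ε₁ :=
    fun a b => abs_div_sub_div_le (hy a b) hs (abs_moment_le hBm a b) hV hδ hB hp1 hηδ
  have hmean : ∀ j, |ceMean φ ρ θ y' y j - (condParam B).1 j| ≤ ε₁ := by
    intro j
    rw [ceMean_apply y' y hθ, condParam_mean_apply hBm hB0]
    exact hratio _ _
  have hm : ∀ j, |(condParam B).1 j| ≤ V / δ := by
    intro j
    rw [condParam_mean_apply hBm hB0, abs_div, abs_of_pos hB0]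
    have := abs_moment_le hBm (some j) none
    gcongr
  set ε : ℝ := 16 * V ^ 2 * η / δ ^ 3 with hε
  have hVδ : 1 ≤ V / δ := by rw [le_div_iff₀ hδ]; linarith
  have hεeq : ε = ε₁ * (4 * (V / δ)) := by
    rw [hε, hε₁]
    field_simp
    ring
  have hε₁ε : ε₁ ≤ ε := by rw [hεeq]; nlinarith
  have hcov : ∀ j k, |(ceCov φ ρ θ y' y - (condParam B).2) j k| ≤ ε := by
    intro j k
    rw [Matrix.sub_apply, ceCov_apply y' y hθ, condParam_cov_apply hBm hB0]
    have h1 := hratio (some j) (some k)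
    have h2 : |ceMean φ ρ θ y' y j * ceMean φ ρ θ y' y k -
        (condParam B).1 j * (condParam B).1 k| ≤ ε₁ * (2 * (V / δ) + 1) := by
      have e : ceMean φ ρ θ y' y j * ceMean φ ρ θ y' y k -
          (condParam B).1 j * (condParam B).1 k =
          (ceMean φ ρ θ y' y j - (condParam B).1 j) * (ceMean φ ρ θ y' y k - (condParam B).1 k) +
          (ceMean φ ρ θ y' y j - (condParam B).1 j) * (condParam B).1 k +
          (condParam B).1 j * (ceMean φ ρ θ y' y k - (condParam B).1 k) := by ring
      rw [e]
      refine (abs_add_three _ _ _).trans ?_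
      rw [abs_mul, abs_mul, abs_mul]
      calc _ ≤ ε₁ * 1 + ε₁ * (V / δ) + V / δ * ε₁ := by
            gcongr
            · exact hmean j
            · exact (hmean k).trans hε₁1
            · exact hmean j
            · exact hm k
            · exact hm j
            · exact hmean k
        _ = _ := by ring
    rw [sub_sub_sub_comm]
    refine (abs_sub _ _).trans ((add_le_add h1 h2).trans ?_)
    rw [hεeq]
    nlinarith
  have hsymm : (ceCov φ ρ θ y' y).IsHermitian := by
    ext j k
    rw [Matrix.conjTranspose_apply, star_trivial, ceCov_apply y' y hθ, ceCov_apply y' y hθ,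
      mul_comm (ceMean φ ρ θ y' y k)]
    simp only [empMoment, momentFun, mul_comm (extCoord (some k) _)]
  refine mem_klBall_of_near hd hδ hB hsymm (τ := d * ε) ?_ (fun v => abs_quadForm_le hcov v)
    (le_of_eq ?_)
  · exact (norm_le_of_abs_le hε₁0 hmean).trans (by gcongr)
  · rw [← hKdef, hε, hη]
    have h1 : (d : ℝ) * (d * (16 * V ^ 2 * (precision δ / d ^ 2) / δ ^ 3)) * K =
        2 * (precision δ * (8 * (V ^ 2 * K))) / δ ^ 3 := by
      field_simp
      ring
    rw [h1, hhδ]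
    field_simp

theorem measurableSet_klBall (C : ℝ) : MeasurableSet (klBall d C) := by
  have hdet : Measurable fun θ : Param d => θ.2.det :=
    ((Continuous.matrix_det continuous_id).measurable).comp measurable_snd
  have htr : Measurable fun θ : Param d => θ.2.trace :=
    ((Continuous.matrix_trace continuous_id).measurable).comp measurable_snd
  have h1 : MeasurableSet {θ : Param d | θ.2.PosSemidef} :=
    isClosed_posSemidef.measurableSet.preimage measurable_snd
  have h2 : MeasurableSet {θ : Param d | θ.2.det ≠ 0} :=
    (hdet (measurableSet_singleton 0)).compl
  have h3 : Measurable (gaussKL : Param d → ℝ) :=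
    ((((measurable_fst.norm.pow_const 2).add htr).sub
      (Real.measurable_log.comp hdet)).sub_const _).div_const _
  have : klBall d C = {θ : Param d | θ.2.PosSemidef} ∩ {θ : Param d | θ.2.det ≠ 0} ∩
      {θ | gaussKL θ ≤ C} := by
    ext θ
    refine and_congr_left fun _ => ⟨fun h => ⟨h.posSemidef, ?_⟩, fun h =>
      h.1.posDef_iff_det_ne_zero.2 h.2⟩
    exact h.posSemidef.posDef_iff_det_ne_zero.1 h
  rw [this]
  exact (h1.inter h2).inter (measurableSet_le h3 measurable_const)

/-- The lower bound for the probability under `f` of a set selected by an empirical quantile. -/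
noncomputable def levelBound (C ρ₀ : ℝ) : ℝ := Real.exp (-(C + Real.log 2) / (ρ₀ / 2))

/-- The bound for the divergence after one iteration. -/
noncomputable def nextBound (C ρ₀ : ℝ) : ℝ := -Real.log (levelBound C ρ₀) + 1

/-- One iteration of the stochastic scheme leads from `klBall d C` to a larger ball, up to an event
whose probability is controlled by the two sample sizes and the dimension. -/
theorem ceStepLaw_compl_klBall_le (hd : 0 < d) {C ρ₀ : ℝ} (hρ₀ : 0 < ρ₀) {φ : E d → ℝ}
    (hφ : Measurable φ) (hatom : ∀ u : ℝ, volume (φ ⁻¹' {u}) = 0) {ρ : ℝ}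
    (hρ : ρ ∈ Set.Ioo (0 : ℝ) 1) (hρρ : ρ₀ ≤ ρ) (hm : 0 < m) (hn : 0 < n) {θ : Param d}
    (hθ : θ ∈ klBall d C) :
    ceStepLaw φ ρ m n θ (klBall d (nextBound C ρ₀))ᶜ ≤
      ENNReal.ofReal (2 / ρ₀ * Real.sqrt (1 / m)) +
        ENNReal.ofReal (4 * momentBound * (2 * Real.exp C + 1) / precision (levelBound C ρ₀) *
          (d ^ 4 * (n : ℝ) ^ (-rateExp C))) := by
  set δ := levelBound C ρ₀ with hδdef
  have hC : 0 ≤ C := (gaussKL_nonneg hθ.1).trans hθ.2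
  have hδ : 0 < δ := Real.exp_pos _
  have hδ1 : δ ≤ 1 := by
    rw [hδdef, levelBound]
    apply Real.exp_le_one_iff.2
    have := Real.log_pos one_lt_two
    rw [neg_div]
    have : 0 ≤ (C + Real.log 2) / (ρ₀ / 2) := by positivity
    linarith
  have hd1 : (1 : ℝ) ≤ d := by exact_mod_cast hd
  have hη : 0 < precision δ / d ^ 2 := div_pos (precision_pos hδ hδ1) (by positivity)
  have hmeas := measurable_ceMean_ceCov (m := m) (n := n) hφ ρ
    (measurable_const (a := θ)) measurable_fst measurable_snd
  have hS := (measurableSet_klBall (d := d) (nextBound C ρ₀)).compl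
  rw [ceStepLaw, Measure.map_apply hmeas hS, Measure.prod_apply (hmeas hS)]
  set bad : Set (Fin m → E d) :=
    {y' | ¬ ρ / 2 ≤ (gaussian θ).real {x | empQuantile φ ρ y' < (φ x : EReal)}} with hbad
  set r : ℝ≥0∞ := ENNReal.ofReal (4 * momentBound * (2 * Real.exp C + 1) / precision δ *
          (d ^ 4 * (n : ℝ) ^ (-rateExp C))) with hr
  have hpt : ∀ y' : Fin m → E d, iidGaussian n θ (Prod.mk y' ⁻¹'
      ((fun a : (Fin m → E d) × (Fin n → E d) => (ceMean φ ρ θ a.1 a.2, ceCov φ ρ θ a.1 a.2)) ⁻¹'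
        (klBall d (nextBound C ρ₀))ᶜ)) ≤ bad.indicator (fun _ => 1) y' + r := by
    intro y'
    by_cases hy' : y' ∈ bad
    · rw [Set.indicator_of_mem hy']
      exact prob_le_one.trans le_self_add
    · rw [Set.indicator_of_notMem hy', zero_add]
      have hB : MeasurableSet {x : E d | empQuantile φ ρ y' < (φ x : EReal)} :=
        measurableSet_lt measurable_const hφ.coe_real_ereal
      have hBδ : δ ≤ probF {x : E d | empQuantile φ ρ y' < (φ x : EReal)} :=
        exp_le_probF (by positivity) hθ hB (le_trans (by linarith) (not_not.1 hy'))
      refine le_trans (measure_mono fun y hy => ?_)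
        ((measure_empMoment_bad_le hθ hn hB hη).trans (ENNReal.ofReal_le_ofReal ?_))
      · by_contra hcon
        simp only [Set.mem_ofPred_eq, not_exists, not_le] at hcon
        exact hy (ce_mem_klBall_of_near hd hφ hθ.1 hδ y' y hBδ fun a b => (hcon a b).le)
      · have hP := precision_pos hδ hδ1
        have hV := one_le_momentBound
        have h4 : ((d : ℝ) + 1) ^ 2 ≤ 4 * d ^ 2 := by nlinarith
        calc _ ≤ 4 * (d : ℝ) ^ 2 * (momentBound * ((2 * Real.exp C + 1) *
              (n : ℝ) ^ (-rateExp C)) / (precision δ / d ^ 2)) := by gcongr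
          _ = _ := by
            field_simp
  calc _ ≤ ∫⁻ y', (bad.indicator (fun _ => 1) y' + r) ∂(iidGaussian m θ) := lintegral_mono hpt
    _ ≤ iidGaussian m θ bad + r := by
        rw [lintegral_add_right _ measurable_const]
        gcongr
        · exact (lintegral_indicator_const_le _ _).trans (by rw [one_mul])
        · simp
    _ ≤ _ := by
        gcongr
        refine (measure_empQuantile_bad_le hφ hatom hρ hθ.1 hm).trans
          (ENNReal.ofReal_le_ofReal ?_)
        gcongr

end OneStep

/-! ### Iteration of the stochastic scheme -/

section Iteration

theorem tendsto_div_rpow_of_le {n : ℕ+ → ℕ} {κ κ' : ℝ} (hκ : κ' ≤ κ)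
    (h : Tendsto (fun d : ℕ+ => (n d : ℝ) / (d : ℝ) ^ κ) atTop atTop) :
    Tendsto (fun d : ℕ+ => (n d : ℝ) / (d : ℝ) ^ κ') atTop atTop := by
  refine tendsto_atTop_mono (fun d => ?_) h
  have hd : (1 : ℝ) ≤ (d : ℝ) := by exact_mod_cast d.pos
  have : (0 : ℝ) < (d : ℝ) ^ κ' := Real.rpow_pos_of_pos (by linarith) _
  gcongr

theorem pow_four_mul_rpow_eq {C x : ℝ} {d : ℝ} (hx : 0 ≤ x) (hd : 0 < d) :
    d ^ 4 * x ^ (-rateExp C) = (x / d ^ (4 / rateExp C)) ^ (-rateExp C) := by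
  have h := (rateExp_pos C).ne'
  rw [Real.div_rpow hx (Real.rpow_nonneg hd.le _), ← Real.rpow_mul hd.le]
  have : 4 / rateExp C * -rateExp C = -(4 : ℕ) := by
    field_simp
    norm_num
  rw [this, Real.rpow_neg hd.le, Real.rpow_natCast]
  field_simp

/-- With probability tending to one, the parameters of the stochastic scheme stay at bounded
divergence from `N(0, I)`, provided that `n_g` grows faster than some power of `d`. -/
theorem exists_ceLaw_klBall {ρ₀ : ℝ} (hρ₀ : 0 < ρ₀) (t : ℕ) : ∃ C κ : ℝ, 0 < κ ∧
    ∀ (φ : ∀ d : ℕ+, E d → ℝ) (hφ : ∀ d, Measurable (φ d)),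
      (∀ (d : ℕ+) (u : ℝ), volume (φ d ⁻¹' {u}) = 0) →
      ∀ ρ : ℕ+ → ℝ, (∀ d, ρ d ∈ Set.Ioo (0 : ℝ) 1) → (∀ d, ρ₀ ≤ ρ d) →
      ∀ m ng : ℕ+ → ℕ, Tendsto m atTop atTop →
        Tendsto (fun d : ℕ+ => (ng d : ℝ) / (d : ℝ) ^ κ) atTop atTop →
        Tendsto (fun d => ceLaw (φ d) (hφ d) (ρ d) (m d) (ng d) t (klBall d C)ᶜ) atTop (𝓝 0) := by
  induction t with
  | zero =>
    refine ⟨0, 1, one_pos, fun φ hφ _ ρ _ _ m ng _ _ => ?_⟩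
    have : ∀ d : ℕ+, ceLaw (φ d) (hφ d) (ρ d) (m d) (ng d) 0 (klBall d 0)ᶜ = 0 := by
      intro d
      rw [ceLaw, Measure.dirac_apply' _ (measurableSet_klBall 0).compl]
      simp [stdParam_mem_klBall]
    simp [this]
  | succ t ih =>
    obtain ⟨C, κ, hκ, ih⟩ := ih
    refine ⟨nextBound C ρ₀, max κ (4 / rateExp C), lt_max_of_lt_left hκ,
      fun φ hφ hatom ρ hρ hρρ m ng hm hng => ?_⟩
    have h1 := ih φ hφ hatom ρ hρ hρρ m ng hm (tendsto_div_rpow_of_le (le_max_left _ _) hng)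
    have h2 : Tendsto (fun d : ℕ+ => ENNReal.ofReal (2 / ρ₀ * Real.sqrt (1 / m d)))
        atTop (𝓝 0) := by
      have h : Tendsto (fun d : ℕ+ => (1 : ℝ) / m d) atTop (𝓝 0) :=
        tendsto_const_nhds.div_atTop (tendsto_natCast_atTop_atTop.comp hm)
      have h' := ENNReal.tendsto_ofReal
        (((Real.continuous_sqrt.tendsto 0).comp h).const_mul (2 / ρ₀))
      simpa using h'
    set W : ℝ := 4 * momentBound * (2 * Real.exp C + 1) / precision (levelBound C ρ₀) with hW
    have hng' := tendsto_div_rpow_of_le (le_max_right κ (4 / rateExp C)) hng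
    have h3 : Tendsto (fun d : ℕ+ => ENNReal.ofReal
        (W * ((d : ℝ) ^ 4 * (ng d : ℝ) ^ (-rateExp C)))) atTop (𝓝 0) := by
      have h := (tendsto_rpow_neg_atTop (rateExp_pos C)).comp hng'
      have h' := ENNReal.tendsto_ofReal (h.const_mul W)
      simp only [mul_zero, ENNReal.ofReal_zero] at h'
      refine h'.congr fun d => ?_
      have hd : (0 : ℝ) < (d : ℝ) := by exact_mod_cast d.pos
      rw [pow_four_mul_rpow_eq (Nat.cast_nonneg _) hd]
      rfl
    have hsum := h1.add (h2.add h3)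
    simp only [add_zero] at hsum
    refine tendsto_of_tendsto_of_tendsto_of_le_of_le' tendsto_const_nhds hsum
      (Eventually.of_forall fun _ => bot_le) ?_
    filter_upwards [hm.eventually_gt_atTop 0, hng'.eventually_gt_atTop 0] with d hmd hngd
    have hn0 : 0 < ng d := by
      rcases Nat.eq_zero_or_pos (ng d) with h0 | h0
      · rw [h0] at hngd
        simp at hngd
      · exact h0
    have hball := (measurableSet_klBall (d := d) C).compl
    rw [ceLaw, Measure.bind_apply (measurableSet_klBall _).compl (Kernel.aemeasurable _)]
    set r : ℝ≥0∞ := ENNReal.ofReal (2 / ρ₀ * Real.sqrt (1 / m d)) + ENNReal.ofReal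
        (W * ((d : ℝ) ^ 4 * (ng d : ℝ) ^ (-rateExp C))) with hr
    calc _ ≤ ∫⁻ θ, ((klBall d C)ᶜ.indicator (fun _ => 1) θ + r)
          ∂(ceLaw (φ d) (hφ d) (ρ d) (m d) (ng d) t) := by
          refine lintegral_mono fun θ => ?_
          by_cases hθ : θ ∈ klBall d C
          · rw [Set.indicator_of_notMem (not_not.2 hθ), zero_add]
            exact ceStepLaw_compl_klBall_le d.pos hρ₀ (hφ d) (hatom d) (hρ d) (hρρ d) hmd hn0 hθ
          · rw [Set.indicator_of_mem hθ]
            exact prob_le_one.trans le_self_add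
      _ = _ := by
          rw [lintegral_add_right _ measurable_const, lintegral_indicator_const hball]
          simp

end Iteration

end CrossEntropy

theorem theorem1
    (φ : ∀ d : ℕ+, CrossEntropy.E d → ℝ) (hφ : ∀ d, Measurable (φ d))
    (q ρ : ℕ+ → ℝ) (hρ : ∀ d, ρ d ∈ Set.Ioo (0 : ℝ) 1)
    (hA : 0 < ⨅ d : ℕ+, CrossEntropy.probF {x | q d ≤ φ d x})
    (hρinf : 0 < ⨅ d : ℕ+, ρ d)
    (hatom : ∀ (d : ℕ+) (u : ℝ), volume (φ d ⁻¹' {u}) = 0) :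
    (∀ t : ℕ, CrossEntropy.EfficientInHighDim (fun _ : ℕ+ => Measure.dirac ())
      (fun d _ => CrossEntropy.detParam (φ d) (ρ d) t) (fun d => {x | q d ≤ φ d x})) ∧
    ∀ m : ℕ+ → ℕ, Tendsto m atTop atTop →
      ∀ t : ℕ, ∃ κ : ℝ, 0 < κ ∧
        ∀ ng : ℕ+ → ℕ, Tendsto (fun d : ℕ+ => (ng d : ℝ) / (d : ℝ) ^ κ) atTop atTop →
          CrossEntropy.EfficientInHighDim
            (fun d => CrossEntropy.ceLaw (φ d) (hφ d) (ρ d) (m d) (ng d) t)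
            (fun _ θ => θ) (fun d => {x | q d ≤ φ d x}) := by
  have hAm : ∀ d : ℕ+, MeasurableSet {x | q d ≤ φ d x} := fun d =>
    measurableSet_le measurable_const (hφ d)
  have hAδ : ∀ d : ℕ+, (⨅ d : ℕ+, CrossEntropy.probF {x | q d ≤ φ d x}) ≤
      CrossEntropy.probF {x | q d ≤ φ d x} := fun d =>
    ciInf_le ⟨0, by rintro _ ⟨e, rfl⟩; exact measureReal_nonneg⟩ d
  have hρρ : ∀ d : ℕ+, (⨅ d : ℕ+, ρ d) ≤ ρ d := fun d =>
    ciInf_le ⟨0, by rintro _ ⟨e, rfl⟩; exact (hρ e).1.le⟩ d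
  refine ⟨fun t => ?_, fun m hm t => ?_⟩
  · obtain ⟨C, hC⟩ := CrossEntropy.exists_detParam_mem_klBall hρinf t
    refine CrossEntropy.efficientInHighDim_of_klBall _ _ _ (fun d => measurable_const) hAm hA hAδ
      C ?_
    have : ∀ d : ℕ+, CrossEntropy.detParam (φ d) (ρ d) t ∈ CrossEntropy.klBall d C := fun d =>
      hC d (φ d) (hφ d) (hatom d) (ρ d) (hρ d) (hρρ d)
    simp [this]
  · obtain ⟨C, κ, hκ, h⟩ := CrossEntropy.exists_ceLaw_klBall hρinf t
    exact ⟨κ, hκ, fun ng hng => CrossEntropy.efficientInHighDim_of_klBall _ _ _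
      (fun d => measurable_id) hAm hA hAδ C (h φ hφ hatom ρ hρ hρρ m ng hm hng)⟩
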